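/- Let $n\ge 1$ and $\varepsilon>1$, and write points of $\mathbb R^{n+1}$ as $Z=(z,Z^{n+1})$ with $z\in\mathbb R^n$. Let $\mathcal U\subset\mathbb R^n$ be a nonempty bounded open set (identified with $\mathcal U\times\{0\}$), let $\psi:\mathbb R^{n+1}\to\mathbb R$ be $C^\infty$ and $\Sigma=\{\psi=0\}$. Let $\mathcal V\subset\Sigma$ be a bounded domain of $\Sigma$, possibly with boundary points: a bounded Borel set with $D\subset\mathcal V\subset\overline D\cap\Sigma$ for some nonempty relatively open $D\subset\Sigma$. Let $f\ge0$ be integrable on $\mathcal U$ and $g\ge 0$ integrable on $\mathcal V$ with respect to the surface measure $\mathcal H^n$; $g$ counts as $0$ off $\mathcal V$. For $a>0$ and $Z\in\mathbb R^{n+1}$ let $H(x,a,Z)=Z^{n+1}-a\varepsilon-a\sqrt{1+\frac{|x-z|^2}{a^2(\varepsilon^2-1)}}$. It is a supporting hyperboloid of $u:\mathcal U\to\mathbb R$ at $x_0\in\mathcal U$ with focus $Z$ if $H(x_0,a,Z)=u(x_0)$ and $H(\cdot,a,Z)\ge u$ on $\mathcal U$. The function $u$ is admissible if it has at each point of $\mathcal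 U$ a supporting hyperboloid with focus in $\mathcal V$. For $\omega\subset\mathcal V$ let $\mathscr S_u(\omega)$ be the set of $x\in\mathcal U$ at which $u$ has a supporting hyperboloid with focus in $\omega$; for $E\subset\mathcal U$ let $\mathscr R_u(E)$ be the set of $Z\in\Sigma$ that are the focus of a supporting hyperboloid of $u$ at some point of $E$. Put $\beta_{u,f}(\omega)=\int_{\mathscr S_u(\omega)}f\,dx$ and $\alpha_{u,g}(E)=\int_{\mathscr R_u(E)}g\,d\mathcal H^n$. An admissible $u$ is a B-type weak solution if $\beta_{u,f}(\omega)=\int_\omega g\,d\mathcal H^n$ for all Borel $\omega\subset\mathcal V$ and $\mathscr S_u(\mathcal V)=\mathcal U$. It is an A-type weak solution if $\int_E f\,dx=\alpha_{u,g}(E)$ for all Borel $E\subset\mathcal U$, $\overline{\mathcal V}\subset\overline{\mathscr R_u(\mathcal U)}$, and $\{x\in\mathcal U:\mathscr R_u(\{x\})\not\subset\mathcal V\}$ is Lebesgue null. Let $m_0>0$ and assume the visibility condition: $\nabla\psi(Z)\cdot(X-Z)>0$ for all $X\in\mathcal U\times[0,m_0]$ and all $Z\in\Sigma$. Let $\rho(z)=\inf\{R>0:\mathcal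 U\subset B_R(z)\}$ and $\bar a(Z)=\frac{\varepsilon Z^{n+1}-\sqrt{(Z^{n+1})^2+\rho(z)^2}}{\varepsilon^2-1}$, and consider the conditions (S) $Z^{n+1}\ge\left[\frac{2}{\varepsilon-1}+\frac1{\sqrt{\varepsilon^2-1}}\right]\rho(z)$ for all $Z\in\mathcal V$; (L) $m_0\ge L_0:=\sup_{x\in\mathcal U,\,Z\in\mathcal V}H(x,\bar a(Z),Z)$; (E) $\int_{\mathcal U}f\,dx=\int_{\mathcal V}g\,d\mathcal H^n$. For a unit vector $\gamma$ and $\kappa=\frac{\varepsilon^2-1}{\varepsilon^2}$ let $Y(\gamma)=\varepsilon\left(e_{n+1}+\left[\sqrt{(\gamma\cdot e_{n+1})^2-\kappa}-\gamma\cdot e_{n+1}\right]\gamma\right)$, the unit direction into which a vertical ray is refracted at a surface with normal $\gamma$. $\mathcal V$ is R-convex with respect to a point $\xi$ if for all unit vectors $\gamma_1,\gamma_2$ the set of $Z\in\mathcal V\setminus\{\xi\}$ with $\frac{Z-\xi}{|Z-\xi|}=Y(\gamma)$ for some normalized combination $\gamma=\frac{c_1\gamma_1+c_2\gamma_2}{|c_1\gamma_1+c_2\gamma_2|}$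 with $\gamma\cdot e_{n+1}\ge\sqrt\kappa$ is connected (possibly empty). Theorem C. (1) If (E), (S) and (L) hold and $\mathcal V$ is closed, then there is a B-type weak solution $u$ with $0\le u\le m_0$. (2) If $\operatorname{dist}(\mathcal U,\mathcal V)>0$, then for every admissible $u$ with $0\le u\le m_0$ the set function $\alpha_{u,g}$ is defined and countably additive on the Borel subsets $E$ of $\mathcal U$ (the sets $\mathscr R_u(E)\cap\mathcal V$ are $\mathcal H^n$-measurable). (3) If $\operatorname{dist}(\mathcal U,\mathcal V)>0$, $\mathcal V$ is R-convex with respect to every point of $\mathcal U\times[0,m_0]$, (S) holds and $g>0$ on $\mathcal V$, then every B-type weak solution $u$ with $0\le u\le m_0$ is also an A-type weak solution. If moreover (E) and (L) hold and $\mathcal V$ is closed, then an A-type weak solution exists. (4) The conclusions of (3) hold without R-convexity if $\operatorname{dist}(\mathcal U,\mathcal V)>0$, (S) holds, and $f>0$ on $\mathcal U$, $g>0$ on $\mathcal V$. -/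

import Mathlib

open MeasureTheory Set
open scoped MeasureTheory ContDiff ENNReal

namespace Refractor

noncomputable section

/-- The horizontal space `ℝⁿ`, with its Euclidean norm. -/
abbrev Base (n : ℕ) : Type := EuclideanSpace ℝ (Fin n)

/-- The space `ℝⁿ⁺¹`, with its Euclidean norm. -/
abbrev Space (n : ℕ) : Type := EuclideanSpace ℝ (Fin (n + 1))

/-- The horizontal projection `z` of a point `Z` of `ℝⁿ⁺¹`. -/
def proj {n : ℕ} (Z : Space n) : Base n := WithLp.toLp 2 fun i : Fin n => Z i.castSucc

/-- The last coordinate `Zⁿ⁺¹` of a point `Z` of `ℝⁿ⁺¹`. -/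
def height {n : ℕ} (Z : Space n) : ℝ := Z (Fin.last n)

/-- The point `(x, h)` of `ℝⁿ⁺¹`. -/
def pt {n : ℕ} (x : Base n) (h : ℝ) : Space n :=
  WithLp.toLp 2 (Fin.snoc (α := fun _ => ℝ) (fun i : Fin n => x i) h)

/-- The vertical unit vector `eₙ₊₁`. -/
def vert (n : ℕ) : Space n := pt 0 1

/-- The receiver surface `Σ = {ψ = 0}`. -/
def receiver {n : ℕ} (ψ : Space n → ℝ) : Set (Space n) := {Z | ψ Z = 0}

/-- `V` is a bounded domain of the hypersurface `S`, possibly together with some of its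
boundary points: it is a bounded Borel set which lies between a nonempty relatively open
subset of `S` and the closure of that subset. -/
def IsTarget {n : ℕ} (S V : Set (Space n)) : Prop :=
  V ⊆ S ∧ Bornology.IsBounded V ∧ MeasurableSet V ∧
    ∃ O : Set (Space n), IsOpen O ∧ (O ∩ S).Nonempty ∧ O ∩ S ⊆ V ∧ V ⊆ closure (O ∩ S)

/-- The lower sheet `H(x, a, Z)` of the hyperboloid of revolution of eccentricity `ε > 1`,
vertical axis, semi-axis `a` and upper focus `Z`. -/
def hyp {n : ℕ} (ε : ℝ) (x : Base n) (a : ℝ) (Z : Space n) : ℝ :=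
  height Z - a * ε - a * √(1 + ‖x - proj Z‖ ^ 2 / (a ^ 2 * (ε ^ 2 - 1)))

/-- `H(·, a, Z)` is a supporting hyperboloid of `u : U → ℝ` at `x₀`. -/
def Supports {n : ℕ} (ε : ℝ) (U : Set (Base n)) (u : Base n → ℝ) (x₀ : Base n) (a : ℝ)
    (Z : Space n) : Prop :=
  0 < a ∧ hyp ε x₀ a Z = u x₀ ∧ ∀ x ∈ U, u x ≤ hyp ε x a Z

/-- Upper admissible functions: at each point of `U` there is a supporting hyperboloid
with focus in `V`. -/
def Admissible {n : ℕ} (ε : ℝ) (U : Set (Base n)) (V : Set (Space n)) (u : Base n → ℝ) : Prop :=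
  ∀ x ∈ U, ∃ Z ∈ V, ∃ a : ℝ, Supports ε U u x a Z

/-- `𝒮_u(B)`: the points of `U` at which `u` has a supporting hyperboloid with focus in `B`. -/
def sourceSet {n : ℕ} (ε : ℝ) (U : Set (Base n)) (u : Base n → ℝ) (B : Set (Space n)) :
    Set (Base n) :=
  {x | x ∈ U ∧ ∃ Z ∈ B, ∃ a : ℝ, Supports ε U u x a Z}

/-- `ℛ_u(E)`: the points of the surface `S` that are the focus of a supporting hyperboloid
of `u` at a point of `E`. -/
def refractorSet {n : ℕ} (ε : ℝ) (U : Set (Base n)) (S : Set (Space n)) (u : Base n → ℝ)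
    (E : Set (Base n)) : Set (Space n) :=
  {Z | Z ∈ S ∧ ∃ x ∈ E, ∃ a : ℝ, Supports ε U u x a Z}

/-- `β_{u,f}(B)`, the integral of `f ≥ 0` over `𝒮_u(B)`. -/
def beta {n : ℕ} (ε : ℝ) (U : Set (Base n)) (u f : Base n → ℝ) (B : Set (Space n)) : ℝ≥0∞ :=
  ∫⁻ x in sourceSet ε U u B, ENNReal.ofReal (f x)

/-- `α_{u,g}(E)`, the integral of `g ≥ 0` over `ℛ_u(E)` with respect to the surface measure;
`g` is a density on `V`, that is, it counts as `0` off `V`. -/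
def alpha {n : ℕ} (ε : ℝ) (U : Set (Base n)) (S V : Set (Space n)) (u : Base n → ℝ)
    (g : Space n → ℝ) (E : Set (Base n)) : ℝ≥0∞ :=
  ∫⁻ Z in refractorSet ε U S u E ∩ V, ENNReal.ofReal (g Z) ∂μHE[n]

/-- `B`-type weak solutions. -/
def IsBType {n : ℕ} (ε : ℝ) (U : Set (Base n)) (V : Set (Space n)) (f : Base n → ℝ)
    (g : Space n → ℝ) (u : Base n → ℝ) : Prop :=
  Admissible ε U V u ∧
  (∀ B : Set (Space n), B ⊆ V → MeasurableSet B →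
    beta ε U u f B = ∫⁻ Z in B, ENNReal.ofReal (g Z) ∂μHE[n]) ∧
  sourceSet ε U u V = U

/-- `A`-type weak solutions. -/
def IsAType {n : ℕ} (ε : ℝ) (U : Set (Base n)) (S V : Set (Space n)) (f : Base n → ℝ)
    (g : Space n → ℝ) (u : Base n → ℝ) : Prop :=
  Admissible ε U V u ∧
  (∀ E : Set (Base n), E ⊆ U → MeasurableSet E →
    ∫⁻ x in E, ENNReal.ofReal (f x) = alpha ε U S V u g E) ∧
  closure V ⊆ closure (refractorSet ε U S u U) ∧
  volume {x | x ∈ U ∧ ¬ refractorSet ε U S u {x} ⊆ V} = 0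

/-- Global energy balance. -/
def EnergyBalance {n : ℕ} (U : Set (Base n)) (V : Set (Space n)) (f : Base n → ℝ)
    (g : Space n → ℝ) : Prop :=
  ∫ x in U, f x = ∫ Z in V, g Z ∂μHE[n]

/-- The slab `U × [0, m₀]`. -/
def slab {n : ℕ} (U : Set (Base n)) (m₀ : ℝ) : Set (Space n) :=
  {X | proj X ∈ U ∧ height X ∈ Icc 0 m₀}

/-- Visibility: `∇ψ(Z) · (X - Z) > 0` for all `X ∈ U × [0, m₀]` and all `Z` with `ψ Z = 0`. -/
def Visible {n : ℕ} (ψ : Space n → ℝ) (U : Set (Base n)) (m₀ : ℝ) : Prop :=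
  ∀ X ∈ slab U m₀, ∀ Z ∈ receiver ψ, 0 < fderiv ℝ ψ Z (X - Z)

/-- `dist(U, V) > 0`, with `U` regarded as a subset of the hyperplane `Xⁿ⁺¹ = 0`. -/
def Separated {n : ℕ} (U : Set (Base n)) (V : Set (Space n)) : Prop :=
  ∃ δ : ℝ, 0 < δ ∧ ∀ x ∈ U, ∀ Z ∈ V, δ ≤ dist (pt x 0) Z

/-- The maximal visibility radius `ρ(z) = inf {R > 0 : U ⊆ B_R(z)}`. -/
def visRadius {n : ℕ} (U : Set (Base n)) (z : Base n) : ℝ :=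
  sInf {R : ℝ | 0 < R ∧ U ⊆ Metric.ball z R}

/-- `Zⁿ⁺¹ ≥ [2/(ε-1) + 1/√(ε²-1)] ρ(z)` for all `Z ∈ V`. -/
def SpanCondition {n : ℕ} (ε : ℝ) (U : Set (Base n)) (V : Set (Space n)) : Prop :=
  ∀ Z ∈ V, (2 / (ε - 1) + 1 / √(ε ^ 2 - 1)) * visRadius U (proj Z) ≤ height Z

/-- The largest semi-axis `ā(Z)` for which the hyperboloid with focus `Z` is nonnegative
over `U`. -/
def maxAxis {n : ℕ} (ε : ℝ) (U : Set (Base n)) (Z : Space n) : ℝ :=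
  (ε * height Z - √(height Z ^ 2 + visRadius U (proj Z) ^ 2)) / (ε ^ 2 - 1)

/-- `m₀` is at least the maximal level `sup {H(x, ā(Z), Z) : x ∈ U, Z ∈ V}`. -/
def AboveMaxLevel {n : ℕ} (ε : ℝ) (U : Set (Base n)) (V : Set (Space n)) (m₀ : ℝ) : Prop :=
  ∀ x ∈ U, ∀ Z ∈ V, hyp ε x (maxAxis ε U Z) Z ≤ m₀

/-- The graph of `u` over `U` lies in the slab `U × [0, m₀]`. -/
def InSlab {n : ℕ} (U : Set (Base n)) (m₀ : ℝ) (u : Base n → ℝ) : Prop :=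
  ∀ x ∈ U, pt x (u x) ∈ slab U m₀

/-- The unit direction `ε (e + (√((γ·e)² - κ) - γ·e) γ)`, with `κ = (ε² - 1)/ε²`, into which a
vertical ray is refracted at a surface with unit normal `γ`. -/
def refractedDir {n : ℕ} (ε : ℝ) (γ : Space n) : Space n :=
  ε • (vert n + (√(inner ℝ γ (vert n) ^ 2 - (ε ^ 2 - 1) / ε ^ 2) - inner ℝ γ (vert n)) • γ)

/-- The refractor cone at `ξ`: the points lying in the refracted directions from `ξ` whose
normal is the normalization of a combination `c₁ γ₁ + c₂ γ₂`.  Only upward normals for which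
the square root in the refracted direction is defined are admitted. -/
def refractorCone {n : ℕ} (ε : ℝ) (ξ γ₁ γ₂ : Space n) : Set (Space n) :=
  {Z | Z ≠ ξ ∧ ∃ c₁ c₂ : ℝ, ∃ γ : Space n,
    c₁ • γ₁ + c₂ • γ₂ ≠ 0 ∧ γ = ‖c₁ • γ₁ + c₂ • γ₂‖⁻¹ • (c₁ • γ₁ + c₂ • γ₂) ∧
    0 < inner ℝ γ (vert n) ∧ (ε ^ 2 - 1) / ε ^ 2 ≤ inner ℝ γ (vert n) ^ 2 ∧
    ‖Z - ξ‖⁻¹ • (Z - ξ) = refractedDir ε γ}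

/-- `V` is `R`-convex with respect to the point `ξ`: for all unit vectors `γ₁, γ₂` the
intersection of `V` with the refractor cone at `ξ` is connected (possibly empty). -/
def IsRConvexAt {n : ℕ} (ε : ℝ) (V : Set (Space n)) (ξ : Space n) : Prop :=
  ∀ γ₁ γ₂ : Space n, ‖γ₁‖ = 1 → ‖γ₂‖ = 1 → IsPreconnected (refractorCone ε ξ γ₁ γ₂ ∩ V)

end

end Refractor

/-!
A hyperboloid with focus `Z` passes through `X` exactly when its semi-axis `a` satisfies
`(ε² - 1) a = ε (Zⁿ⁺¹ - Xⁿ⁺¹) - |Z - X|`; this quantity, `axisThrough ε X Z`, decreases with the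
height of `X`.  Hence `Z` is a focus of `u` at `x` if and only if `axisThrough ε (y, u y) Z` is
positive and minimal over `y ∈ U` at `y = x` (`isFocus_iff`).  This is a formulation in which `x`
and `Z` play dual roles, and everything about the measures rests on two uniqueness statements.

* For almost every `x` there is at most one focus on the receiver (`ae_focus_unique`).  An
  admissible `u` is Lipschitz, so differentiable almost everywhere by Rademacher's theorem.
  Minimality then fixes the component of the ray direction tangential to the graph, hence, by the
  sign of its normal component, the direction itself.  By visibility a ray meets the receiver
  once, as `ψ` decreases at each crossing.
* Almost every point of the receiver, for the surface measure, is a focus at one point at most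
  (`focus_double_null`).  The minimum of `axisThrough` over the graph, `envelope ε U u`, is a
  Lipschitz function of `Z`; the receiver is locally a Lipschitz graph, so that it has a tangential
  derivative almost everywhere (`ae_tangentially_differentiable`).  There the tangential component
  of the incoming direction is determined, and by visibility all rays arrive from the same side
  of the receiver.  The value of the envelope then determines the distance.

The preimages of Borel sets under a relation that is almost everywhere single-valued are null
measurable, and those of disjoint sets overlap in a null set (`nullMeasurableSet_exists`,
`aedisjoint_exists`); this gives the countable additivity of `α`.  The energy balance of a solution
of type B carries over to type A (`IsBType.lintegral_eq_alpha`) because a null subset of the target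
receives no energy: outside a set of `x` without energy, `x ∈ E` is equivalent to `x` being
refracted into `ℛ_u(E)`.  Positivity of `g` gives the density of the foci in the target, since
nonempty relatively open subsets of the receiver have positive surface measure.

For the existence of a solution of type B (`exists_isBType`), the target is first replaced by
finitely many points (`exists_discrete`).  Among the semi-axes for which at least one is maximal
and each nonmaximal one has a piece with at least the prescribed energy, those of minimal sum
solve the problem: a piece with an excess could have its semi-axis decreased.  Since one semi-axis
is maximal, the surface has points near level `0` and stays below `m₀`; the span condition bounds
the semi-axes away from `0`.  Surfaces for finer and finer discretizations of the target are
equi-Lipschitz, and a limit refracts at least `∫_K g` into each compact `K`.  Equality follows,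
as the total energies agree.
-/

namespace Refractor

open Filter Topology

/-! ### Coordinates and the equation of a hyperboloid -/

theorem proj_pt {n : ℕ} (x : Base n) (h : ℝ) : proj (pt x h) = x := by
  ext i; simp [proj, pt]

theorem height_pt {n : ℕ} (x : Base n) (h : ℝ) : height (pt x h) = h := by
  simp [height, pt]

theorem pt_proj_height {n : ℕ} (Z : Space n) : pt (proj Z) (height Z) = Z := by
  ext i
  refine Fin.lastCases ?_ (fun j => ?_) i <;> simp [proj, pt, height]

theorem pt_add {n : ℕ} (x y : Base n) (h k : ℝ) : pt (x + y) (h + k) = pt x h + pt y k := by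
  ext i
  refine Fin.lastCases ?_ (fun j => ?_) i <;> simp [pt]

theorem pt_smul {n : ℕ} (c : ℝ) (x : Base n) (h : ℝ) : pt (c • x) (c * h) = c • pt x h := by
  ext i
  refine Fin.lastCases ?_ (fun j => ?_) i <;> simp [pt]

theorem pt_sub {n : ℕ} (x y : Base n) (h k : ℝ) : pt (x - y) (h - k) = pt x h - pt y k := by
  ext i
  refine Fin.lastCases ?_ (fun j => ?_) i <;> simp [pt]

theorem norm_pt_sq {n : ℕ} (x : Base n) (h : ℝ) : ‖pt x h‖ ^ 2 = ‖x‖ ^ 2 + h ^ 2 := by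
  simp [EuclideanSpace.norm_sq_eq, Fin.sum_univ_castSucc, pt]

theorem inner_vert {n : ℕ} (Y : Space n) : inner ℝ Y (vert n) = height Y := by
  simp [PiLp.inner_apply, Fin.sum_univ_castSucc, vert, pt, height]

theorem height_sub {n : ℕ} (Y Z : Space n) : height (Y - Z) = height Y - height Z := rfl

theorem height_smul {n : ℕ} (c : ℝ) (Z : Space n) : height (c • Z) = c * height Z := rfl

theorem height_vert (n : ℕ) : height (vert n) = 1 := height_pt _ _

theorem height_le_norm {n : ℕ} (Z : Space n) : |height Z| ≤ ‖Z‖ := by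
  have := norm_pt_sq (proj Z) (height Z)
  rw [pt_proj_height] at this
  exact abs_le_of_sq_le_sq (by nlinarith [sq_nonneg ‖proj Z‖]) (norm_nonneg _)

theorem continuous_height {n : ℕ} : Continuous (height : Space n → ℝ) := by
  unfold height; fun_prop

theorem continuous_proj {n : ℕ} : Continuous (proj : Space n → Base n) := by
  unfold proj; fun_prop

theorem continuous_pt {n : ℕ} : Continuous fun q : Base n × ℝ => pt q.1 q.2 := by
  unfold pt
  refine (PiLp.continuous_toLp 2 _).comp (continuous_pi fun i => ?_)
  refine Fin.lastCases ?_ (fun j => ?_) i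
  · simpa using continuous_snd
  · simp only [Fin.snoc_castSucc]; fun_prop

/-- The map `(x, h) ↦ pt x h` as a continuous linear map. -/
noncomputable def ptL (n : ℕ) : Base n × ℝ →L[ℝ] Space n where
  toFun q := pt q.1 q.2
  map_add' _ _ := pt_add _ _ _ _
  map_smul' _ _ := pt_smul _ _ _
  cont := continuous_pt

/-- The semi-axis, up to the factor `ε² - 1`, of the hyperboloid with focus `Z` passing
through `X`.  It is the difference between the optical length, for the refractive index `ε`, of
the vertical segment from `X` to the level of `Z`, and the length of the ray from `X` to `Z`. -/
noncomputable def axisThrough {n : ℕ} (ε : ℝ) (X Z : Space n) : ℝ :=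
  ε * (height Z - height X) - dist X Z

theorem continuous_axisThrough {n : ℕ} (ε : ℝ) :
    Continuous fun q : Space n × Space n => axisThrough ε q.1 q.2 := by
  unfold axisThrough
  have := continuous_height (n := n)
  fun_prop

theorem hyp_eq {n : ℕ} {ε a : ℝ} (ha : 0 < a) (x : Base n) (Z : Space n) :
    hyp ε x a Z = height Z - a * ε - √(a ^ 2 + ‖x - proj Z‖ ^ 2 / (ε ^ 2 - 1)) := by
  have : a * √(1 + ‖x - proj Z‖ ^ 2 / (a ^ 2 * (ε ^ 2 - 1))) =
      √(a ^ 2 + ‖x - proj Z‖ ^ 2 / (ε ^ 2 - 1)) := by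
    have h1 : a ^ 2 + ‖x - proj Z‖ ^ 2 / (ε ^ 2 - 1) =
        a ^ 2 * (1 + ‖x - proj Z‖ ^ 2 / (a ^ 2 * (ε ^ 2 - 1))) := by
      rw [mul_add, mul_one, ← mul_div_assoc, mul_div_mul_left _ _ (by positivity)]
    rw [h1, Real.sqrt_mul (by positivity), Real.sqrt_sq ha.le]
  rw [hyp, this]

theorem dist_pt_sq {n : ℕ} (x : Base n) (s : ℝ) (Z : Space n) :
    dist (pt x s) Z ^ 2 = ‖x - proj Z‖ ^ 2 + (height Z - s) ^ 2 := by
  have : pt x s - Z = pt (x - proj Z) (s - height Z) := by rw [pt_sub, pt_proj_height]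
  rw [dist_eq_norm, this, norm_pt_sq]; ring

/-- Raising the point `X` decreases the semi-axis of the hyperboloid through it. -/
theorem axisThrough_pt_lt {n : ℕ} {ε : ℝ} (hε : 1 < ε) (x : Base n) (Z : Space n) {s t : ℝ}
    (h : s < t) : axisThrough ε (pt x t) Z < axisThrough ε (pt x s) Z := by
  have h1 : dist (pt x s) Z ≤ dist (pt x s) (pt x t) + dist (pt x t) Z := dist_triangle _ _ _
  have h2 : dist (pt x s) (pt x t) = t - s := by
    have := dist_pt_sq x s (pt x t)
    rw [proj_pt, height_pt, sub_self, norm_zero] at this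
    exact (pow_left_inj₀ dist_nonneg (by linarith) two_ne_zero).1 (by linarith)
  unfold axisThrough
  rw [height_pt, height_pt]
  nlinarith

/-- The point of the hyperboloid `H(·, a, Z)` above `x` has semi-axis `a`. -/
theorem axisThrough_hyp {n : ℕ} {ε a : ℝ} (hε : 1 < ε) (ha : 0 < a) (x : Base n) (Z : Space n) :
    axisThrough ε (pt x (hyp ε x a Z)) Z = (ε ^ 2 - 1) * a := by
  have he : 0 < ε ^ 2 - 1 := by nlinarith
  set q := √(a ^ 2 + ‖x - proj Z‖ ^ 2 / (ε ^ 2 - 1)) with hq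
  have hq2 : q ^ 2 = a ^ 2 + ‖x - proj Z‖ ^ 2 / (ε ^ 2 - 1) := Real.sq_sqrt (by positivity)
  have hq0 : 0 ≤ q := Real.sqrt_nonneg _
  have ht : height Z - hyp ε x a Z = a * ε + q := by rw [hyp_eq ha]; ring
  have hr : ‖x - proj Z‖ ^ 2 = (ε ^ 2 - 1) * (q ^ 2 - a ^ 2) := by
    rw [hq2]; field_simp; ring
  -- with `t = Zⁿ⁺¹ - Xⁿ⁺¹ = a ε + q`, the focal distance is `ε q + a`
  have hd : dist (pt x (hyp ε x a Z)) Z = ε * q + a := by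
    have := dist_pt_sq x (hyp ε x a Z) Z
    rw [ht, hr] at this
    refine (pow_left_inj₀ dist_nonneg (by positivity) two_ne_zero).1 ?_
    rw [this]; ring
  unfold axisThrough
  rw [height_pt, hd, ht]; ring

theorem le_hyp_iff {n : ℕ} {ε a : ℝ} (hε : 1 < ε) (ha : 0 < a) (x : Base n) (Z : Space n)
    (s : ℝ) : s ≤ hyp ε x a Z ↔ (ε ^ 2 - 1) * a ≤ axisThrough ε (pt x s) Z := by
  rw [← axisThrough_hyp hε ha x Z]
  constructor
  · intro h
    rcases h.eq_or_lt with h | h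
    · rw [h]
    · exact (axisThrough_pt_lt hε x Z h).le
  · intro h
    by_contra! h'
    exact absurd (axisThrough_pt_lt hε x Z h') (not_lt.2 h)

theorem hyp_eq_iff {n : ℕ} {ε a : ℝ} (hε : 1 < ε) (ha : 0 < a) (x : Base n) (Z : Space n)
    (s : ℝ) : hyp ε x a Z = s ↔ axisThrough ε (pt x s) Z = (ε ^ 2 - 1) * a := by
  constructor
  · rintro rfl; exact axisThrough_hyp hε ha x Z
  · intro h
    rw [← axisThrough_hyp hε ha x Z] at h
    rcases lt_trichotomy (hyp ε x a Z) s with h' | h' | h'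
    · exact absurd h (axisThrough_pt_lt hε x Z h').ne
    · exact h'
    · exact absurd h (axisThrough_pt_lt hε x Z h').ne'

/-- `Z` is the focus of a supporting hyperboloid of `u` at the point `x` of `U`. -/
def IsFocus {n : ℕ} (ε : ℝ) (U : Set (Base n)) (u : Base n → ℝ) (x : Base n) (Z : Space n) :
    Prop :=
  ∃ a : ℝ, Supports ε U u x a Z

/-- The foci at `x` are the points `Z` for which the semi-axis of the hyperboloid with
focus `Z` through the points of the graph of `u` is positive and minimal above `x`. -/
theorem isFocus_iff {n : ℕ} {ε : ℝ} (hε : 1 < ε) {U : Set (Base n)} {u : Base n → ℝ}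
    {x : Base n} {Z : Space n} :
    IsFocus ε U u x Z ↔ 0 < axisThrough ε (pt x (u x)) Z ∧
      ∀ y ∈ U, axisThrough ε (pt x (u x)) Z ≤ axisThrough ε (pt y (u y)) Z := by
  have he : 0 < ε ^ 2 - 1 := by nlinarith
  constructor
  · rintro ⟨a, ha, h1, h2⟩
    rw [hyp_eq_iff hε ha] at h1
    rw [h1]
    exact ⟨by positivity, fun y hy => (le_hyp_iff hε ha _ _ _).1 (h2 y hy)⟩
  · rintro ⟨h1, h2⟩
    have ha : 0 < axisThrough ε (pt x (u x)) Z / (ε ^ 2 - 1) := by positivity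
    have e : (ε ^ 2 - 1) * (axisThrough ε (pt x (u x)) Z / (ε ^ 2 - 1)) =
      axisThrough ε (pt x (u x)) Z := by field_simp
    refine ⟨_, ha, (hyp_eq_iff hε ha _ _ _).2 e.symm, fun y hy => (le_hyp_iff hε ha _ _ _).2 ?_⟩
    rw [e]; exact h2 y hy

theorem sqrt_sq_add_sq_le (a s t : ℝ) : √(a ^ 2 + s ^ 2) ≤ √(a ^ 2 + t ^ 2) + |s - t| := by
  have h1 : |t| ≤ √(a ^ 2 + t ^ 2) := Real.abs_le_sqrt (by nlinarith [sq_nonneg a])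
  have h2 : √(a ^ 2 + t ^ 2) ^ 2 = a ^ 2 + t ^ 2 := Real.sq_sqrt (by positivity)
  rw [Real.sqrt_le_left (by positivity)]
  have h3 : t * (s - t) ≤ |t| * |s - t| := by rw [← abs_mul]; exact le_abs_self _
  nlinarith [sq_abs (s - t), mul_le_mul_of_nonneg_right h1 (abs_nonneg (s - t))]

theorem hyp_sub_le {n : ℕ} {ε a : ℝ} (hε : 1 < ε) (ha : 0 < a) (x y : Base n) (Z : Space n) :
    hyp ε x a Z ≤ hyp ε y a Z + 1 / √(ε ^ 2 - 1) * dist x y := by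
  have he : 0 < ε ^ 2 - 1 := by nlinarith
  have key : ∀ w : Base n, ‖w - proj Z‖ ^ 2 / (ε ^ 2 - 1) =
      (‖w - proj Z‖ / √(ε ^ 2 - 1)) ^ 2 := fun w => by
    rw [div_pow, Real.sq_sqrt he.le]
  rw [hyp_eq ha, hyp_eq ha, key, key]
  have h1 := sqrt_sq_add_sq_le a (‖y - proj Z‖ / √(ε ^ 2 - 1)) (‖x - proj Z‖ / √(ε ^ 2 - 1))
  have h2 : |‖y - proj Z‖ / √(ε ^ 2 - 1) - ‖x - proj Z‖ / √(ε ^ 2 - 1)| ≤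
      1 / √(ε ^ 2 - 1) * dist x y := by
    rw [← sub_div, abs_div, abs_of_pos (Real.sqrt_pos.2 he), div_mul_eq_mul_div, one_mul]
    gcongr
    have := abs_norm_sub_norm_le (y - proj Z) (x - proj Z)
    rwa [sub_sub_sub_cancel_right, ← dist_eq_norm y x, dist_comm] at this
  linarith

/-- An admissible function is Lipschitz, with a constant depending on `ε` only. -/
theorem Admissible.lipschitzOnWith {n : ℕ} {ε : ℝ} (hε : 1 < ε) {U : Set (Base n)}
    {V : Set (Space n)} {u : Base n → ℝ} (hu : Admissible ε U V u) :
    LipschitzOnWith (Real.toNNReal (1 / √(ε ^ 2 - 1))) u U := by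
  refine LipschitzOnWith.of_le_add_mul _ fun x hx y hy => ?_
  obtain ⟨Z, -, a, ha, h1, h2⟩ := hu y hy
  rw [Real.coe_toNNReal _ (by positivity), ← h1]
  exact (h2 x hx).trans (hyp_sub_le hε ha x y Z)

/-! ### Uniqueness of the focus at almost every point -/

theorem hasDerivAt_norm {E : Type*} [NormedAddCommGroup E] [InnerProductSpace ℝ E] {Y : ℝ → E}
    {w : E} {t : ℝ} (h : HasDerivAt Y w t) (h0 : Y t ≠ 0) :
    HasDerivAt (fun s => ‖Y s‖) (inner ℝ (‖Y t‖⁻¹ • Y t) w) t := by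
  have h1 := (h.norm_sq).sqrt (by positivity)
  have h2 : (fun s => √(‖Y s‖ ^ 2)) = fun s => ‖Y s‖ := by
    ext s; exact Real.sqrt_sq (norm_nonneg _)
  rw [h2] at h1
  convert! h1 using 1
  rw [Real.sqrt_sq (norm_nonneg _), real_inner_smul_left]
  field_simp

/-- Two unit vectors on the same side of a hyperplane with the same tangential component
agree. -/
theorem eq_of_sub_eq_smul {E : Type*} [NormedAddCommGroup E] [InnerProductSpace ℝ E]
    {e₁ e₂ N : E} {c : ℝ} (h₁ : ‖e₁‖ = 1) (h₂ : ‖e₂‖ = 1) (hN₁ : 0 < inner ℝ e₁ N)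
    (hN₂ : 0 < inner ℝ e₂ N) (h : e₁ - e₂ = c • N) : e₁ = e₂ := by
  have e : inner ℝ (e₁ - e₂) (e₁ + e₂) = (0 : ℝ) := by
    rw [inner_sub_left, inner_add_right, inner_add_right, real_inner_self_eq_norm_sq,
      real_inner_self_eq_norm_sq, h₁, h₂, real_inner_comm]; ring
  rw [h, real_inner_smul_left, inner_add_right, real_inner_comm, real_inner_comm e₂] at e
  have hc : c = 0 := by
    rcases mul_eq_zero.1 e with h | h
    · exact h
    · linarith
  rwa [hc, zero_smul, sub_eq_zero] at h

/-- Derivative of the semi-axis along a curve of base points. -/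
theorem hasDerivAt_axisThrough_left {n : ℕ} {ε : ℝ} {X : ℝ → Space n} {w Z : Space n} {t : ℝ}
    (h : HasDerivAt X w t) (h0 : X t ≠ Z) :
    HasDerivAt (fun s => axisThrough ε (X s) Z)
      (inner ℝ (‖Z - X t‖⁻¹ • (Z - X t) - ε • vert n) w) t := by
  have h1 := hasDerivAt_norm (h.sub_const Z) (sub_ne_zero.2 h0)
  have h2 : HasDerivAt (fun s => height (X s)) (height w) t := by
    have := ((hasDerivAt_const t (vert n)).inner ℝ h)
    simp only [real_inner_comm, inner_vert, inner_zero_left, add_zero] at this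
    exact this
  have h3 := ((h2.const_sub (height Z)).const_mul ε).sub h1
  have e : (fun s => axisThrough ε (X s) Z) =
      fun s => ε * (height Z - height (X s)) - ‖X s - Z‖ := by
    ext s; rw [axisThrough, dist_eq_norm]
  rw [e]
  convert! h3 using 1
  rw [inner_sub_left, real_inner_smul_left, real_inner_smul_left, real_inner_comm w (vert n),
    inner_vert, norm_sub_rev (X t), real_inner_smul_left, ← neg_sub (X t) Z,
    inner_neg_left]
  ring

/-- The symmetry between base points and foci. -/
theorem axisThrough_neg_neg {n : ℕ} (ε : ℝ) (X Z : Space n) :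
    axisThrough ε X Z = axisThrough ε (-Z) (-X) := by
  unfold axisThrough
  rw [dist_neg_neg, dist_comm]
  have : ∀ Y : Space n, height (-Y) = -height Y := fun _ => rfl
  rw [this, this]; ring

/-- Derivative of the semi-axis along a curve of foci. -/
theorem hasDerivAt_axisThrough_right {n : ℕ} {ε : ℝ} {X w : Space n} {Z : ℝ → Space n} {t : ℝ}
    (h : HasDerivAt Z w t) (h0 : X ≠ Z t) :
    HasDerivAt (fun s => axisThrough ε X (Z s))
      (inner ℝ (ε • vert n - ‖Z t - X‖⁻¹ • (Z t - X)) w) t := by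
  have := hasDerivAt_axisThrough_left (ε := ε) (X := fun s => -Z s) (Z := -X) h.neg
    (fun h => h0 (neg_injective h.symm))
  simp only [← axisThrough_neg_neg] at this
  convert! this using 1
  rw [show -X - -Z t = Z t - X by abel, inner_neg_right, ← inner_neg_left, neg_sub]

theorem Visible.ne {n : ℕ} {ψ : Space n → ℝ} {U : Set (Base n)} {m₀ : ℝ}
    (h : Visible ψ U m₀) {X Z : Space n} (hX : X ∈ slab U m₀) (hZ : Z ∈ receiver ψ) : X ≠ Z := by
  rintro rfl
  have := h X hX X hZ
  simp at this

theorem Visible.fderiv_ne_zero {n : ℕ} {ψ : Space n → ℝ} {U : Set (Base n)} {m₀ : ℝ}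
    (hvis : Visible ψ U m₀) {X : Space n} (hX : X ∈ slab U m₀) {Z : Space n}
    (hZ : Z ∈ receiver ψ) : fderiv ℝ ψ Z ≠ 0 := fun h => by
  have := hvis X hX Z hZ
  simp [h] at this

/-- Each ray issued from the slab meets the receiver at most once, since it crosses it from
`ψ > 0` to `ψ < 0` each time. -/
theorem Visible.eq_of_ray {n : ℕ} {ψ : Space n → ℝ} (hψ : Differentiable ℝ ψ)
    {U : Set (Base n)} {m₀ : ℝ} (h : Visible ψ U m₀) {X e : Space n} (hX : X ∈ slab U m₀)
    {s t : ℝ} (hs : 0 < s) (ht : 0 < t) (h1 : X + s • e ∈ receiver ψ)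
    (h2 : X + t • e ∈ receiver ψ) : s = t := by
  wlog hst : s < t generalizing s t
  · rcases (not_lt.1 hst).eq_or_lt with h' | h'
    · exact h'.symm
    · exact (this ht hs h2 h1 h').symm
  exfalso
  have hd : ∀ r : ℝ, HasDerivAt (fun r => ψ (X + r • e)) (fderiv ℝ ψ (X + r • e) e) r := by
    intro r
    have h3 : HasDerivAt (fun r : ℝ => X + r • e) e r := by
      simpa using ((hasDerivAt_id r).smul_const e).const_add X
    exact (hψ _).hasFDerivAt.comp_hasDerivAt r h3
  have hneg : ∀ r : ℝ, 0 < r → ψ (X + r • e) = 0 → fderiv ℝ ψ (X + r • e) e < 0 := by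
    intro r hr h0
    have := h X hX _ h0
    rw [show X - (X + r • e) = (-r) • e by rw [neg_smul]; abel, map_smul, smul_eq_mul] at this
    nlinarith
  have hle : ∀ ⦃r⦄, r ∈ Icc s t → ψ (X + r • e) ≤ 0 := by
    refine image_le_of_deriv_right_lt_deriv_boundary' (f' := fun r => fderiv ℝ ψ (X + r • e) e)
      (B := fun _ => 0) (B' := fun _ => 0) (fun r _ => (hd r).continuousAt.continuousWithinAt)
      (fun r _ => (hd r).hasDerivWithinAt) (le_of_eq h1) continuousOn_const
      (fun r _ => hasDerivWithinAt_const _ _ _) fun r hr h0 => hneg r (hs.trans_le hr.1) h0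
  have h4 := hneg t ht h2
  have h5 : ∀ᶠ r in 𝓝[<] t, 0 < ψ (X + r • e) := by
    have h6 := (hd t).tendsto_slope
    have h7 := (h6.mono_left (nhdsLT_le_nhdsNE t)).eventually (gt_mem_nhds h4)
    filter_upwards [h7, self_mem_nhdsWithin] with r hr hrt
    have e2 : ψ (X + t • e) = 0 := h2
    rw [slope_def_field, e2, sub_zero, div_lt_iff_of_neg (sub_neg.2 hrt)] at hr
    simpa using hr
  have h8 : ∀ᶠ r in 𝓝[<] t, r ∈ Icc s t := Icc_mem_nhdsLT hst
  obtain ⟨r, hr1, hr2⟩ := (h5.and h8).exists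
  exact absurd (hle hr2) (not_le.2 hr1)

/-- The unit direction of the ray from `X` to `Z`. -/
noncomputable def dir {n : ℕ} (X Z : Space n) : Space n := ‖Z - X‖⁻¹ • (Z - X)

theorem norm_dir {n : ℕ} {X Z : Space n} (h : X ≠ Z) : ‖dir X Z‖ = 1 := by
  have : ‖Z - X‖ ≠ 0 := norm_ne_zero_iff.2 (sub_ne_zero.2 h.symm)
  rw [dir, norm_smul, norm_inv, norm_norm, inv_mul_cancel₀ this]

theorem add_norm_smul_dir {n : ℕ} {X Z : Space n} (h : X ≠ Z) : X + ‖Z - X‖ • dir X Z = Z := by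
  have : ‖Z - X‖ ≠ 0 := norm_ne_zero_iff.2 (sub_ne_zero.2 h.symm)
  rw [dir, smul_smul, mul_inv_cancel₀ this, one_smul, add_sub_cancel]

/-- The semi-axis in terms of the refracted direction. -/
theorem axisThrough_eq_mul {n : ℕ} (ε : ℝ) {X Z : Space n} (h : X ≠ Z) :
    axisThrough ε X Z = ‖Z - X‖ * (ε * height (dir X Z) - 1) := by
  have : ‖Z - X‖ ≠ 0 := norm_ne_zero_iff.2 (sub_ne_zero.2 h.symm)
  rw [axisThrough, dist_comm, dist_eq_norm, dir, height_smul, height_sub]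
  field_simp

/-- At a point of differentiability of `u`, the refracted direction of a focus is determined by
the tangent hyperplane of the graph of `u`. -/
theorem inner_dir_sub_eq_zero {n : ℕ} {ε : ℝ} (hε : 1 < ε) {U : Set (Base n)} (hU : IsOpen U)
    {u : Base n → ℝ} {x : Base n} (hx : x ∈ U) {p : Base n →L[ℝ] ℝ} (hp : HasFDerivAt u p x)
    {Z : Space n} (hZ : IsFocus ε U u x Z) (hXZ : pt x (u x) ≠ Z) (v : Base n) :
    inner ℝ (dir (pt x (u x)) Z - ε • vert n) (pt v (p v)) = 0 := by
  have hl : HasDerivAt (fun t : ℝ => x + t • v) v 0 := by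
    simpa using ((hasDerivAt_id (0 : ℝ)).smul_const v).const_add x
  have hu : HasDerivAt (fun t : ℝ => u (x + t • v)) (p v) 0 := by
    refine HasFDerivAt.comp_hasDerivAt (0 : ℝ) (l := u) ?_ hl
    simpa using hp
  have hX : HasDerivAt (fun t : ℝ => pt (x + t • v) (u (x + t • v))) (pt v (p v)) 0 := by
    exact (ptL n).hasFDerivAt.comp_hasDerivAt (0 : ℝ) (hl.prodMk hu)
  have hd := hasDerivAt_axisThrough_left (ε := ε) (Z := Z) hX (by simpa using hXZ)
  have hmin : IsLocalMin (fun t : ℝ => axisThrough ε (pt (x + t • v) (u (x + t • v))) Z) 0 := by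
    have h1 : ∀ᶠ t : ℝ in 𝓝 0, x + t • v ∈ U :=
      hl.continuousAt.eventually_mem (by simpa using hU.mem_nhds hx)
    filter_upwards [h1] with t ht
    simpa using ((isFocus_iff hε).1 hZ).2 _ ht
  simpa [dir] using hmin.hasDerivAt_eq_zero hd

/-- Two foci at a point of differentiability lie on the same ray. -/
theorem dir_eq_dir_of_hasFDerivAt {n : ℕ} {ε : ℝ} (hε : 1 < ε) {U : Set (Base n)}
    (hU : IsOpen U) {u : Base n → ℝ} {x : Base n} (hx : x ∈ U) {p : Base n →L[ℝ] ℝ}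
    (hp : HasFDerivAt u p x) {Z₁ Z₂ : Space n} (h₁ : IsFocus ε U u x Z₁)
    (h₂ : IsFocus ε U u x Z₂) (hX₁ : pt x (u x) ≠ Z₁) (hX₂ : pt x (u x) ≠ Z₂) :
    dir (pt x (u x)) Z₁ = dir (pt x (u x)) Z₂ := by
  set X := pt x (u x)
  have hlt : ∀ {Z}, X ≠ Z → 0 < ε - height (dir X Z) := fun {Z} hXZ => by
    have := (le_abs_self _).trans (height_le_norm (dir X Z))
    rw [norm_dir hXZ] at this; linarith
  have hpos : ∀ {Z}, X ≠ Z → IsFocus ε U u x Z → 0 < ε * height (dir X Z) - 1 :=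
    fun {Z} hXZ hZ => by
    have := ((isFocus_iff hε).1 hZ).1
    rw [axisThrough_eq_mul ε hXZ] at this
    exact pos_of_mul_pos_right this (norm_nonneg _)
  -- a vector orthogonal to the graph is determined by its height
  have hperp : ∀ {Z}, X ≠ Z → IsFocus ε U u x Z → ∀ Y : Space n,
      inner ℝ (dir X Z - ε • vert n) Y =
        (height Y - p (proj Y)) * (height (dir X Z) - ε) := fun {Z} hXZ hZ Y => by
    have h3 := inner_dir_sub_eq_zero hε hU hx hp hZ hXZ (proj Y)
    have h4 : Y = pt (proj Y) (p (proj Y)) + (height Y - p (proj Y)) • vert n := by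
      rw [vert, ← pt_smul, ← pt_add]
      simp [pt_proj_height]
    conv_lhs => rw [h4]
    rw [inner_add_right, h3, real_inner_smul_right, inner_vert, zero_add, height_sub,
      height_smul, height_vert, mul_one]
  set l₁ := ε - height (dir X Z₁) with hl₁
  set l₂ := ε - height (dir X Z₂) with hl₂
  have hcol : l₂ • (dir X Z₁ - ε • vert n) = l₁ • (dir X Z₂ - ε • vert n) := by
    refine ext_inner_right ℝ fun Y => ?_
    rw [real_inner_smul_left, real_inner_smul_left, hperp hX₁ h₁, hperp hX₂ h₂]
    ring
  have p₁ : 0 < l₁ := hlt hX₁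
  have p₂ : 0 < l₂ := hlt hX₂
  set N : Space n := l₁⁻¹ • (ε • vert n - dir X Z₁) with hN
  have hN₂ : N = l₂⁻¹ • (ε • vert n - dir X Z₂) := by
    rw [hN, inv_smul_eq_iff₀ p₁.ne', smul_comm, eq_inv_smul_iff₀ p₂.ne', ← neg_sub (dir X Z₁),
      ← neg_sub (dir X Z₂), smul_neg, smul_neg, hcol]
  have hin : ∀ {Z}, X ≠ Z → IsFocus ε U u x Z → ∀ l : ℝ, 0 < l →
      0 < inner ℝ (dir X Z) (l⁻¹ • (ε • vert n - dir X Z)) := fun {Z} hXZ hZ l hl => by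
    rw [real_inner_smul_right, inner_sub_right, real_inner_smul_right, inner_vert,
      real_inner_self_eq_norm_sq, norm_dir hXZ]
    have := hpos hXZ hZ
    have : 0 < ε * height (dir X Z) - 1 ^ 2 := by linarith
    positivity
  refine eq_of_sub_eq_smul (N := N) (c := l₂ - l₁) (norm_dir hX₁) (norm_dir hX₂)
    (hin hX₁ h₁ _ p₁) (hN₂ ▸ hin hX₂ h₂ _ p₂) ?_
  rw [sub_smul]
  nth_rewrite 1 [hN₂]
  rw [hN, smul_inv_smul₀ p₂.ne', smul_inv_smul₀ p₁.ne']
  abel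

/-- At almost every point, the receiver contains at most one focus: the refractor map is
single-valued almost everywhere. -/
theorem ae_focus_unique {n : ℕ} {ε : ℝ} (hε : 1 < ε) {U : Set (Base n)} (hU : IsOpen U)
    {ψ : Space n → ℝ} (hψ : Differentiable ℝ ψ) {m₀ : ℝ} (hvis : Visible ψ U m₀)
    {u : Base n → ℝ} {K : NNReal} (hL : LipschitzOnWith K u U) (hs : InSlab U m₀ u) :
    ∀ᵐ x, x ∈ U → ∀ Z₁ ∈ receiver ψ, ∀ Z₂ ∈ receiver ψ, IsFocus ε U u x Z₁ →
      IsFocus ε U u x Z₂ → Z₁ = Z₂ := by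
  filter_upwards [hL.ae_differentiableWithinAt_of_mem (μ := volume)] with x hx hxU
    Z₁ hZ₁ Z₂ hZ₂ h₁ h₂
  have hd := ((hx hxU).differentiableAt (hU.mem_nhds hxU)).hasFDerivAt
  have n₁ := hvis.ne (hs x hxU) hZ₁
  have n₂ := hvis.ne (hs x hxU) hZ₂
  have hdir := dir_eq_dir_of_hasFDerivAt hε hU hxU hd h₁ h₂ n₁ n₂
  have e₁ := add_norm_smul_dir n₁
  have e₂ := add_norm_smul_dir n₂
  rw [← hdir] at e₂
  have := hvis.eq_of_ray hψ (hs x hxU) (norm_pos_iff.2 (sub_ne_zero.2 n₁.symm))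
    (norm_pos_iff.2 (sub_ne_zero.2 n₂.symm)) (e := dir (pt x (u x)) Z₁) (by rwa [e₁]) (by rwa [e₂])
  rw [← e₁, ← e₂, this]

/-! ### The surface measure of a smooth hypersurface -/

/-- The linear projection that deletes the `i`-th coordinate. -/
noncomputable def dropCoord {n : ℕ} (i : Fin (n + 1)) : Space n →L[ℝ] Base n :=
  LinearMap.toContinuousLinearMap
    { toFun := fun Z => WithLp.toLp 2 fun j => Z (i.succAbove j)
      map_add' := fun _ _ => rfl
      map_smul' := fun _ _ => rfl }

theorem norm_sq_eq_dropCoord {n : ℕ} (i : Fin (n + 1)) (Z : Space n) :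
    ‖Z‖ ^ 2 = Z i ^ 2 + ‖dropCoord i Z‖ ^ 2 := by
  have h : ∀ j, dropCoord i Z j = Z (i.succAbove j) := fun _ => rfl
  simp [EuclideanSpace.norm_sq_eq, Fin.sum_univ_succAbove _ i, h]

theorem lipschitzWith_dropCoord {n : ℕ} (i : Fin (n + 1)) :
    LipschitzWith 1 (dropCoord i : Space n → Base n) := by
  refine LipschitzWith.of_dist_le_mul fun Y Z => ?_
  rw [dist_eq_norm, dist_eq_norm, ← map_sub, NNReal.coe_one, one_mul]
  refine le_of_sq_le_sq ?_ (norm_nonneg _)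
  rw [norm_sq_eq_dropCoord i (Y - Z)]
  nlinarith [sq_nonneg ((Y - Z) i)]

theorem exists_injective_prod_dropCoord {n : ℕ} {L : Space n →L[ℝ] ℝ} (hL : L ≠ 0) :
    ∃ i, Function.Injective (L.prod (dropCoord i)) := by
  obtain ⟨i, hi⟩ : ∃ i, L (EuclideanSpace.single i 1) ≠ 0 := by
    by_contra! h
    refine hL (ContinuousLinearMap.coe_injective ?_)
    exact (EuclideanSpace.basisFun (Fin (n + 1)) ℝ).toBasis.ext fun i => by simpa using h i
  refine ⟨i, (injective_iff_map_eq_zero _).2 fun v hv => ?_⟩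
  have h1 : L v = 0 := congrArg Prod.fst hv
  have h2 : dropCoord i v = 0 := congrArg Prod.snd hv
  have h3 : v = v i • EuclideanSpace.single i (1 : ℝ) := by
    ext j
    rcases Fin.eq_self_or_eq_succAbove i j with rfl | ⟨k, rfl⟩
    · simp
    · have : v (i.succAbove k) = 0 := congrArg (fun w : Base n => w k) h2
      simp [this]
  rw [h3, map_smul, smul_eq_mul] at h1
  rw [h3, (mul_eq_zero.1 h1).resolve_right hi, zero_smul]

/-- Near a regular point, a level set is a Lipschitz graph over a coordinate hyperplane. -/
theorem exists_antilipschitz_dropCoord {n : ℕ} {ψ : Space n → ℝ} {L : Space n →L[ℝ] ℝ}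
    {Z₀ : Space n} (hψ : HasStrictFDerivAt ψ L Z₀) {i : Fin (n + 1)}
    (hi : Function.Injective (L.prod (dropCoord i))) :
    ∃ K : NNReal, ∃ N : Set (Space n), IsOpen N ∧ Z₀ ∈ N ∧
      ∀ Y ∈ N ∩ receiver ψ, ∀ Z ∈ N ∩ receiver ψ,
        dist Y Z ≤ K * dist (dropCoord i Y) (dropCoord i Z) := by
  obtain ⟨K, hK0, hK⟩ := (L.prod (dropCoord i) : Space n →ₗ[ℝ] ℝ × Base n).exists_antilipschitzWith
    (LinearMap.ker_eq_bot.2 hi)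
  have hK0' : (0 : ℝ) < K := hK0
  obtain ⟨s, hs, hs'⟩ := hψ.approximates_deriv_on_nhds (c := (2 * K)⁻¹) (Or.inr (by positivity))
  obtain ⟨N, hNs, hNo, hN⟩ := mem_nhds_iff.1 hs
  refine ⟨K, N, hNo, hN, fun Y hY Z hZ => ?_⟩
  have h1 := hs' Y (hNs hY.1) Z (hNs hZ.1)
  have eY : ψ Y = 0 := hY.2
  have eZ : ψ Z = 0 := hZ.2
  rw [eY, eZ, sub_self, zero_sub, norm_neg] at h1
  push_cast at h1
  have h2 := hK.le_mul_dist Y Z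
  have h3 : dist ((L.prod (dropCoord i)) Y) ((L.prod (dropCoord i)) Z) =
      max ‖L (Y - Z)‖ (dist (dropCoord i Y) (dropCoord i Z)) := by
    rw [Prod.dist_eq, map_sub, ← dist_eq_norm]; rfl
  have h2' : dist Y Z ≤ K * max ‖L (Y - Z)‖ (dist (dropCoord i Y) (dropCoord i Z)) :=
    h2.trans_eq (by rw [← h3]; rfl)
  rcases le_total ‖L (Y - Z)‖ (dist (dropCoord i Y) (dropCoord i Z)) with h | h
  · rwa [max_eq_right h] at h2'
  · rw [max_eq_left h] at h2'
    rw [← dist_eq_norm] at h1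
    have h5 : (K : ℝ) * ((2 * (K : ℝ))⁻¹ * dist Y Z) = dist Y Z / 2 := by field_simp
    have h6 := mul_le_mul_of_nonneg_left h1 hK0'.le
    have h7 : dist Y Z ≤ 0 := by linarith
    exact h7.trans (by positivity)

theorem euclideanHausdorff_eq_zero_iff {X : Type*} [MetricSpace X] [MeasurableSpace X]
    [BorelSpace X] (d : ℕ) (s : Set X) :
    μHE[d] s = 0 ↔ Measure.hausdorffMeasure (d : ℝ) s = 0 := by
  rw [Measure.euclideanHausdorffMeasure_def, Measure.smul_apply, smul_eq_zero]
  exact or_iff_right (Measure.addHaarScalarFactor_volume_hausdorffMeasure_ne_zero d)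

/-- A subset of a Lipschitz graph is null as soon as its projection is null. -/
theorem euclideanHausdorff_eq_zero_of_dropCoord {n : ℕ} {i : Fin (n + 1)} {K : NNReal}
    {S : Set (Space n)} (hS : ∀ Y ∈ S, ∀ Z ∈ S,
      dist Y Z ≤ K * dist (dropCoord i Y) (dropCoord i Z)) {D : Set (Base n)}
    (hD : volume D = 0) : μHE[n] (S ∩ dropCoord i ⁻¹' D) = 0 := by
  rw [← EuclideanSpace.euclideanHausdorffMeasure_eq_volume, euclideanHausdorff_eq_zero_iff] at hD
  have hanti : AntilipschitzWith K fun Y : S => dropCoord i (Y : Space n) :=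
    AntilipschitzWith.of_le_mul_dist fun Y Z => hS Y Y.2 Z Z.2
  have h1 := hanti.hausdorffMeasure_preimage_le (d := n) (by positivity) D
  rw [hD, mul_zero, nonpos_iff_eq_zero] at h1
  have h2 : S ∩ dropCoord i ⁻¹' D =
      Subtype.val '' ((fun Y : S => dropCoord i (Y : Space n)) ⁻¹' D) := by
    ext Y; simp [and_comm]
  rw [h2, euclideanHausdorff_eq_zero_iff, isometry_subtype_coe.hausdorffMeasure_image, h1]
  exact Or.inl (by positivity)

/-- Rademacher's theorem on a regular level set: a Lipschitz function has a tangential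
derivative at almost every point, with respect to the surface measure. -/
theorem ae_tangentially_differentiable {n : ℕ} {ψ : Space n → ℝ} (hψ : ContDiff ℝ ∞ ψ)
    (hreg : ∀ Z ∈ receiver ψ, fderiv ℝ ψ Z ≠ 0) {b : Space n → ℝ} {M : NNReal}
    (hb : LipschitzWith M b) :
    μHE[n] {Z | Z ∈ receiver ψ ∧ ¬ ∃ l : Space n →L[ℝ] ℝ, ∀ (γ : ℝ → Space n) (w : Space n),
      γ 0 = Z → HasDerivAt γ w 0 → (∀ᶠ t in 𝓝 0, γ t ∈ receiver ψ) →
        HasDerivAt (fun t => b (γ t)) (l w) 0} = 0 := by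
  refine measure_null_of_locally_null _ fun Z₀ hZ₀ => ?_
  have hst : HasStrictFDerivAt ψ (fderiv ℝ ψ Z₀) Z₀ :=
    hψ.contDiffAt.hasStrictFDerivAt (by simp)
  obtain ⟨i, hi⟩ := exists_injective_prod_dropCoord (hreg Z₀ hZ₀.1)
  obtain ⟨K, N, hNo, hZN, hN⟩ := exists_antilipschitz_dropCoord hst hi
  set S := N ∩ receiver ψ
  have hinj : InjOn (dropCoord i) S := fun Y hY Z hZ h => by
    have := hN Y hY Z hZ
    rw [h, dist_self, mul_zero] at this
    exact dist_le_zero.1 this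
  -- `b` restricted to the graph, read in the coordinate hyperplane
  have hc : LipschitzOnWith (M * K) (fun y => b (Function.invFunOn (dropCoord i) S y))
      (dropCoord i '' S) := by
    refine LipschitzOnWith.of_dist_le_mul ?_
    rintro _ ⟨Y, hY, rfl⟩ _ ⟨Z, hZ, rfl⟩
    rw [hinj.leftInvOn_invFunOn hY, hinj.leftInvOn_invFunOn hZ]
    refine (hb.dist_le_mul Y Z).trans ?_
    rw [NNReal.coe_mul, mul_assoc]
    gcongr
    exact hN Y hY Z hZ
  obtain ⟨c, hcL, hcE⟩ := hc.extend_real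
  have hD : volume {y | ¬ DifferentiableAt ℝ c y} = 0 := hcL.ae_differentiableAt
  refine ⟨_, inter_mem_nhdsWithin _ (hNo.mem_nhds hZN), measure_mono_null ?_
    (euclideanHausdorff_eq_zero_of_dropCoord hN hD)⟩
  rintro Z ⟨⟨hZ, hZ'⟩, hZN⟩
  refine ⟨⟨hZN, hZ⟩, fun hdiff => hZ' ⟨(fderiv ℝ c (dropCoord i Z)).comp (dropCoord i), ?_⟩⟩
  rintro γ w rfl hγ hmem
  have h1 : HasDerivAt (fun t => c (dropCoord i (γ t)))
      (fderiv ℝ c (dropCoord i (γ 0)) (dropCoord i w)) 0 :=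
    hdiff.hasFDerivAt.comp_hasDerivAt (0 : ℝ) ((dropCoord i).hasFDerivAt.comp_hasDerivAt 0 hγ)
  refine h1.congr_of_eventuallyEq ?_
  filter_upwards [hmem, hγ.continuousAt.eventually_mem (hNo.mem_nhds hZN)] with t ht1 ht2
  have := hcE (mem_image_of_mem (dropCoord i) (⟨ht2, ht1⟩ : γ t ∈ S))
  rw [← this]
  simp only [hinj.leftInvOn_invFunOn (⟨ht2, ht1⟩ : γ t ∈ S)]

/-- Every tangent vector of a regular level set is the velocity of a curve in it. -/
theorem exists_curve {n : ℕ} {ψ : Space n → ℝ} {L : Space n →L[ℝ] ℝ} {Z v : Space n}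
    (hψ : HasStrictFDerivAt ψ L Z) (hL : L ≠ 0) (hZ : Z ∈ receiver ψ) (hv : L v = 0) :
    ∃ γ : ℝ → Space n, γ 0 = Z ∧ HasDerivAt γ v 0 ∧ ∀ᶠ t in 𝓝 0, γ t ∈ receiver ψ := by
  have hr : L.range = ⊤ := by
    refine LinearMap.range_eq_top.2 (LinearMap.surjective fun h => hL ?_)
    exact ContinuousLinearMap.coe_injective h
  let w : L.ker := ⟨v, hv⟩
  have hl : HasDerivAt (fun t : ℝ => t • w) w 0 := by
    simpa using (hasDerivAt_id (0 : ℝ)).smul_const w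
  have h0 : HasFDerivAt (hψ.implicitFunction ψ L hr (ψ Z)) L.ker.subtypeL ((0 : ℝ) • w) := by
    rw [zero_smul]; exact (hψ.to_implicitFunction hr).hasFDerivAt
  have h2 := HasFDerivAt.comp_hasDerivAt (0 : ℝ) h0 hl
  refine ⟨fun t => hψ.implicitFunction ψ L hr (ψ Z) (t • w), by simp, h2, ?_⟩
  have h1 : Tendsto (fun t : ℝ => (ψ Z, t • w)) (𝓝 0) (𝓝 (ψ Z, 0)) := by
    refine tendsto_const_nhds.prodMk_nhds ?_
    simpa using hl.continuousAt.tendsto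
  filter_upwards [h1.eventually (hψ.map_implicitFunction_eq hr)] with t ht
  exact ht.trans hZ

/-- A nonempty relatively open subset of a regular level set has positive surface measure. -/
theorem euclideanHausdorff_pos {n : ℕ} {ψ : Space n → ℝ} {L : Space n →L[ℝ] ℝ} {Z₀ : Space n}
    (hψ : HasStrictFDerivAt ψ L Z₀) (hL : L ≠ 0) {O : Set (Space n)} (hO : IsOpen O)
    (hZ₀ : Z₀ ∈ O ∩ receiver ψ) : 0 < μHE[n] (O ∩ receiver ψ) := by
  obtain ⟨i, hi⟩ := exists_injective_prod_dropCoord hL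
  have hsurj : (L.prod (dropCoord i)).range = ⊤ := by
    refine LinearMap.range_eq_top.2 ?_
    refine (LinearMap.injective_iff_surjective_of_finrank_eq_finrank ?_).1 hi
    simp [add_comm]
  have hmap := (hψ.prodMk (dropCoord i).hasStrictFDerivAt).map_nhds_eq_of_surj hsurj
  have h1 : (fun Z => (ψ Z, dropCoord i Z)) '' O ∈ 𝓝 (ψ Z₀, dropCoord i Z₀) :=
    hmap ▸ image_mem_map (hO.mem_nhds hZ₀.1)
  have h2 : dropCoord i '' (O ∩ receiver ψ) ∈ 𝓝 (dropCoord i Z₀) := by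
    have h3 : Tendsto (fun y : Base n => (ψ Z₀, y)) (𝓝 (dropCoord i Z₀))
      (𝓝 (ψ Z₀, dropCoord i Z₀)) := tendsto_const_nhds.prodMk_nhds tendsto_id
    filter_upwards [h3 h1] with y hy
    obtain ⟨Z, hZ, hZy⟩ := hy
    exact ⟨Z, ⟨hZ, (congrArg Prod.fst hZy).trans hZ₀.2⟩, congrArg Prod.snd hZy⟩
  have h4 := Measure.measure_pos_of_mem_nhds volume h2
  rw [pos_iff_ne_zero] at h4 ⊢
  refine fun h => h4 ?_
  rw [euclideanHausdorff_eq_zero_iff] at h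
  rw [← EuclideanSpace.euclideanHausdorffMeasure_eq_volume, euclideanHausdorff_eq_zero_iff]
  have h5 := (lipschitzWith_dropCoord i).lipschitzOnWith.hausdorffMeasure_image_le
    (s := O ∩ receiver ψ) (d := n) (by positivity)
  rw [h, mul_zero] at h5
  exact nonpos_iff_eq_zero.1 h5

/-! ### Almost everywhere single-valued relations -/

theorem measurableSet_exists_le {α β : Type*} [TopologicalSpace α] [MeasurableSpace α]
    [BorelSpace α] [TopologicalSpace β] {s : Set α} (hs : MeasurableSet s) {K : Set β}
    (hK : IsCompact K) {G : α → β → ℝ} (hG : ContinuousOn (Function.uncurry G) (s ×ˢ K)) :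
    MeasurableSet {x | x ∈ s ∧ ∃ z ∈ K, G x z ≤ 0} := by
  have := isCompact_iff_compactSpace.1 hK
  have hc : Continuous fun q : s × K => G q.1 q.2 := by
    have : Continuous fun q : s × K => (⟨(q.1, q.2), q.1.2, q.2.2⟩ : ↥(s ×ˢ K)) := by fun_prop
    exact (continuousOn_iff_continuous_domRestrict.1 hG).comp this
  have h1 : IsClosed (Prod.fst '' {q : s × K | G q.1 q.2 ≤ 0}) :=
    isClosedMap_fst_of_compactSpace _ (isClosed_le hc continuous_const)
  have h2 : {x | x ∈ s ∧ ∃ z ∈ K, G x z ≤ 0} =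
      Subtype.val '' (Prod.fst '' {q : s × K | G q.1 q.2 ≤ 0}) := by
    ext x
    constructor
    · rintro ⟨hx, z, hz, h⟩
      exact ⟨⟨x, hx⟩, ⟨(⟨x, hx⟩, ⟨z, hz⟩), h, rfl⟩, rfl⟩
    · rintro ⟨_, ⟨⟨x, z⟩, h, rfl⟩, rfl⟩
      exact ⟨x.2, z, z.2, h⟩
  rw [h2]
  exact hs.subtype_image h1.measurableSet

/-- The preimages of Borel sets under a relation which is almost everywhere single-valued are
measurable as soon as those of compact sets are. -/
theorem nullMeasurableSet_exists {α β : Type*} [MeasurableSpace α] {μ : Measure α}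
    [TopologicalSpace β] [SigmaCompactSpace β] [MeasurableSpace β] [BorelSpace β]
    {r : α → β → Prop} (hK : ∀ K, IsCompact K → NullMeasurableSet {x | ∃ y ∈ K, r x y} μ)
    (hr : ∀ᵐ x ∂μ, ∀ y₁ y₂, r x y₁ → r x y₂ → y₁ = y₂) {B : Set β} (hB : MeasurableSet B) :
    NullMeasurableSet {x | ∃ y ∈ B, r x y} μ := by
  have hU : ∀ s : ℕ → Set β, {x | ∃ y ∈ ⋃ i, s i, r x y} = ⋃ i, {x | ∃ y ∈ s i, r x y} := by
    intro s; ext x; simp only [mem_iUnion, mem_ofPred_eq]; tauto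
  have hF : ∀ F : Set β, IsClosed F → NullMeasurableSet {x | ∃ y ∈ F, r x y} μ := by
    intro F hF
    have : F = ⋃ i, compactCovering β i ∩ F := by
      rw [← iUnion_inter, iUnion_compactCovering, univ_inter]
    rw [this, hU]
    exact .iUnion fun i => hK _ ((isCompact_compactCovering β i).inter_right hF)
  have hC : ∀ s : Set β, NullMeasurableSet {x | ∃ y ∈ s, r x y} μ →
      NullMeasurableSet {x | ∃ y ∈ sᶜ, r x y} μ := by
    intro s hs
    refine ((hF univ isClosed_univ).diff hs).congr ?_
    filter_upwards [hr] with x hx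
    refine propext ⟨?_, ?_⟩
    · rintro ⟨⟨y, -, hy⟩, h⟩
      exact ⟨y, fun hys => h ⟨y, hys, hy⟩, hy⟩
    · rintro ⟨y, hys, hy⟩
      refine ⟨⟨y, trivial, hy⟩, ?_⟩
      rintro ⟨z, hz, hz'⟩
      exact hys (hx y z hy hz' ▸ hz)
  induction B, hB using MeasurableSet.induction_on_open with
  | isOpen s hs => simpa using hC _ (hF _ hs.isClosed_compl)
  | compl s hs ih => exact hC _ ih
  | iUnion s _ _ ih => rw [hU]; exact .iUnion ih

theorem aedisjoint_exists {α β : Type*} [MeasurableSpace α] {μ : Measure α} {r : α → β → Prop}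
    (hr : ∀ᵐ x ∂μ, ∀ y₁ y₂, r x y₁ → r x y₂ → y₁ = y₂) {B C : Set β} (hBC : Disjoint B C) :
    AEDisjoint μ {x | ∃ y ∈ B, r x y} {x | ∃ y ∈ C, r x y} := by
  refine measure_mono_null ?_ hr
  rintro x ⟨⟨y, hy, hxy⟩, z, hz, hxz⟩ h
  exact hBC.ne_of_mem hy hz (h y z hxy hxz)

/-! ### The dual envelope and the points in which several rays meet -/

/-- The largest semi-axis (times `ε² - 1`) of a hyperboloid with focus `Z` which stays above
the graph of `u`; it plays the role of a Legendre transform of `u`. -/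
noncomputable def envelope {n : ℕ} (ε : ℝ) (U : Set (Base n)) (u : Base n → ℝ) (Z : Space n) : ℝ :=
  ⨅ x : U, axisThrough ε (pt (x : Base n) (u x)) Z

theorem axisThrough_sub_le {n : ℕ} {ε : ℝ} (hε : 1 < ε) (X Y Z : Space n) :
    axisThrough ε X Y ≤ axisThrough ε X Z + (ε + 1) * dist Y Z := by
  have h1 := (le_abs_self _).trans (height_le_norm (Y - Z))
  rw [height_sub, ← dist_eq_norm] at h1
  have h2 := dist_triangle X Y Z
  unfold axisThrough
  nlinarith

theorem bddBelow_axisThrough {n : ℕ} {ε : ℝ} (hε : 1 < ε) {U : Set (Base n)}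
    (hU : Bornology.IsBounded U) {m₀ : ℝ} {u : Base n → ℝ} (hs : InSlab U m₀ u) (Z : Space n) :
    BddBelow (range fun x : U => axisThrough ε (pt (x : Base n) (u x)) Z) := by
  obtain ⟨R, hR⟩ := hU.subset_closedBall (proj Z)
  refine ⟨ε * (height Z - m₀) - (R + |height Z| + m₀), ?_⟩
  rintro _ ⟨⟨x, hx⟩, rfl⟩
  have h1 := (hs x hx).2
  rw [height_pt] at h1
  have h2 : ‖x - proj Z‖ ≤ R := by rw [← dist_eq_norm]; exact hR hx
  have h3 : dist (pt x (u x)) Z ≤ R + |height Z| + m₀ := by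
    have h4 := dist_pt_sq x (u x) Z
    have h5 : |height Z - u x| ≤ |height Z| + m₀ := by
      refine (abs_sub _ _).trans ?_
      rw [abs_of_nonneg h1.1]; linarith [h1.2]
    have h6 := norm_nonneg (x - proj Z)
    have h7 := abs_nonneg (height Z - u x)
    refine le_of_sq_le_sq ?_ (by linarith)
    rw [h4, ← sq_abs (height Z - u x)]
    nlinarith
  change _ ≤ axisThrough ε (pt x (u x)) Z
  unfold axisThrough
  rw [height_pt]
  nlinarith [h1.2]

theorem envelope_le {n : ℕ} {ε : ℝ} (hε : 1 < ε) {U : Set (Base n)}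
    (hU : Bornology.IsBounded U) {m₀ : ℝ} {u : Base n → ℝ} (hs : InSlab U m₀ u) (Z : Space n)
    {x : Base n} (hx : x ∈ U) : envelope ε U u Z ≤ axisThrough ε (pt x (u x)) Z :=
  ciInf_le (bddBelow_axisThrough hε hU hs Z) (⟨x, hx⟩ : U)

theorem lipschitzWith_envelope {n : ℕ} {ε : ℝ} (hε : 1 < ε) {U : Set (Base n)}
    (hU : Bornology.IsBounded U) (hUn : U.Nonempty) {m₀ : ℝ} {u : Base n → ℝ}
    (hs : InSlab U m₀ u) : LipschitzWith (Real.toNNReal (ε + 1)) (envelope ε U u) := by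
  have := hUn.to_subtype
  refine LipschitzWith.of_le_add_mul _ fun Y Z => ?_
  rw [Real.coe_toNNReal _ (by linarith), ← sub_le_iff_le_add]
  refine le_ciInf fun x => ?_
  rw [sub_le_iff_le_add]
  exact (envelope_le hε hU hs Y x.2).trans (axisThrough_sub_le hε _ _ _)

theorem isFocus_iff_envelope {n : ℕ} {ε : ℝ} (hε : 1 < ε) {U : Set (Base n)}
    (hU : Bornology.IsBounded U) (hUn : U.Nonempty) {m₀ : ℝ} {u : Base n → ℝ}
    (hs : InSlab U m₀ u) {x : Base n} (hx : x ∈ U) {Z : Space n} :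
    IsFocus ε U u x Z ↔
      0 < envelope ε U u Z ∧ axisThrough ε (pt x (u x)) Z ≤ envelope ε U u Z := by
  have := hUn.to_subtype
  rw [isFocus_iff hε]
  constructor
  · rintro ⟨h1, h2⟩
    have : axisThrough ε (pt x (u x)) Z ≤ envelope ε U u Z := le_ciInf fun y => h2 y y.2
    exact ⟨h1.trans_le this, this⟩
  · rintro ⟨h1, h2⟩
    exact ⟨h1.trans_le (envelope_le hε hU hs Z hx), fun y hy =>
      h2.trans (envelope_le hε hU hs Z hy)⟩

/-- The set of points of the receiver that are foci at two distinct points is null for the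
surface measure: where the envelope is tangentially differentiable, the tangential component
of the incoming direction is determined, and the rays arrive from the side `ψ > 0`. -/
theorem focus_double_null {n : ℕ} {ε : ℝ} (hε : 1 < ε) {U : Set (Base n)}
    (hU : Bornology.IsBounded U) (hUn : U.Nonempty) {ψ : Space n → ℝ} (hψ : ContDiff ℝ ∞ ψ)
    {m₀ : ℝ} (hvis : Visible ψ U m₀) {u : Base n → ℝ} (hs : InSlab U m₀ u) :
    μHE[n] {Z | Z ∈ receiver ψ ∧ ∃ x ∈ U, ∃ y ∈ U, x ≠ y ∧ IsFocus ε U u x Z ∧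
      IsFocus ε U u y Z} = 0 := by
  obtain ⟨x₀, hx₀⟩ := hUn
  have hreg : ∀ Z ∈ receiver ψ, fderiv ℝ ψ Z ≠ 0 := fun Z hZ =>
    hvis.fderiv_ne_zero (hs x₀ hx₀) hZ
  refine measure_mono_null ?_ (ae_tangentially_differentiable hψ hreg
    (lipschitzWith_envelope hε hU ⟨x₀, hx₀⟩ hs))
  rintro Z ⟨hZ, x, hx, y, hy, hxy, hfx, hfy⟩
  refine ⟨hZ, ?_⟩
  rintro ⟨l, hl⟩
  have hst : HasStrictFDerivAt ψ (fderiv ℝ ψ Z) Z :=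
    hψ.contDiffAt.hasStrictFDerivAt (by simp)
  have htan : ∀ z ∈ U, IsFocus ε U u z Z → ∀ v, fderiv ℝ ψ Z v = 0 →
      inner ℝ (ε • vert n - dir (pt z (u z)) Z) v = l v := by
    intro z hz hf v hv
    obtain ⟨γ, hγ0, hγ, hγm⟩ := exists_curve hst (hreg Z hZ) hZ hv
    have h1 := hl γ v hγ0 hγ hγm
    have h2 := hasDerivAt_axisThrough_right (ε := ε) (X := pt z (u z)) hγ
      (by rw [hγ0]; exact hvis.ne (hs z hz) hZ)
    have hmin : IsLocalMin (fun t => axisThrough ε (pt z (u z)) (γ t) - envelope ε U u (γ t)) 0 := by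
      refine Filter.Eventually.of_forall fun t => ?_
      have h3 := ((isFocus_iff_envelope hε hU ⟨x₀, hx₀⟩ hs hz).1 hf).2
      have h4 := envelope_le hε hU hs (γ t) hz
      simp only [hγ0]
      linarith
    have h5 := hmin.hasDerivAt_eq_zero (h2.sub h1)
    rw [hγ0] at h5
    exact sub_eq_zero.1 h5
  set N : Space n := -(InnerProductSpace.toDual ℝ (Space n)).symm (fderiv ℝ ψ Z) with hN
  have hNv : ∀ v, inner ℝ N v = -fderiv ℝ ψ Z v := fun v => by
    rw [hN, inner_neg_left, InnerProductSpace.toDual_symm_apply]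
  have hpos : ∀ z ∈ U, 0 < inner ℝ (dir (pt z (u z)) Z) N := fun z hz => by
    have h1 := hvis _ (hs z hz) Z hZ
    have h2 : (0 : ℝ) < ‖Z - pt z (u z)‖⁻¹ :=
      inv_pos.2 (norm_pos_iff.2 (sub_ne_zero.2 (hvis.ne (hs z hz) hZ).symm))
    rw [real_inner_comm, hNv, dir, map_smul, smul_eq_mul, ← mul_neg, ← map_neg, neg_sub]
    exact mul_pos h2 h1
  have hN0 : inner ℝ N N ≠ (0 : ℝ) := fun h => by
    have := hpos x hx
    rw [inner_self_eq_zero.1 h, inner_zero_right] at this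
    exact lt_irrefl _ this
  set d := dir (pt x (u x)) Z - dir (pt y (u y)) Z with hd
  have hdv : ∀ v, fderiv ℝ ψ Z v = 0 → inner ℝ d v = 0 := fun v hv => by
    have h1 := htan x hx hfx v hv
    have h2 := htan y hy hfy v hv
    rw [inner_sub_left] at h1 h2
    rw [hd, inner_sub_left]; linarith
  have hdN : d = (inner ℝ N d / inner ℝ N N) • N := by
    set w := d - (inner ℝ N d / inner ℝ N N) • N with hw
    have h1 : inner ℝ N w = 0 := by
      rw [hw, inner_sub_right, real_inner_smul_right, div_mul_cancel₀ _ hN0, sub_self]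
    have h2 : inner ℝ d w = 0 := hdv w (by have := hNv w; rw [h1] at this; linarith)
    have h3 : inner ℝ w w = 0 := by
      nth_rewrite 1 [hw]
      rw [inner_sub_left, real_inner_smul_left, h1, h2, mul_zero, sub_zero]
    exact sub_eq_zero.1 (inner_self_eq_zero.1 h3)
  have nx := hvis.ne (hs x hx) hZ
  have ny := hvis.ne (hs y hy) hZ
  have hdir := eq_of_sub_eq_smul (norm_dir nx) (norm_dir ny) (hpos x hx) (hpos y hy) hdN
  have hx' := (isFocus_iff hε).1 hfx
  have hy' := (isFocus_iff hε).1 hfy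
  have heq := le_antisymm (hx'.2 y hy) (hy'.2 x hx)
  have hx0 := hx'.1
  rw [axisThrough_eq_mul ε nx] at heq hx0
  rw [axisThrough_eq_mul ε ny, ← hdir] at heq
  have hnorm := mul_right_cancel₀ (pos_of_mul_pos_right hx0 (norm_nonneg _)).ne' heq
  have ey := add_norm_smul_dir ny
  rw [← hdir, ← hnorm] at ey
  have := congrArg proj (add_right_cancel ((add_norm_smul_dir nx).trans ey.symm))
  rw [proj_pt, proj_pt] at this
  exact hxy this

/-! ### Measurability of the source sets and of the refractor sets -/

theorem mem_sourceSet {n : ℕ} {ε : ℝ} {U : Set (Base n)} {u : Base n → ℝ} {B : Set (Space n)}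
    {x : Base n} : x ∈ sourceSet ε U u B ↔ x ∈ U ∧ ∃ Z ∈ B, IsFocus ε U u x Z := Iff.rfl

theorem mem_refractorSet {n : ℕ} {ε : ℝ} {U : Set (Base n)} {S : Set (Space n)}
    {u : Base n → ℝ} {E : Set (Base n)} {Z : Space n} :
    Z ∈ refractorSet ε U S u E ↔ Z ∈ S ∧ ∃ x ∈ E, IsFocus ε U u x Z := Iff.rfl

theorem sourceSet_eq {n : ℕ} {ε : ℝ} {U : Set (Base n)} {S : Set (Space n)} {u : Base n → ℝ}
    {B : Set (Space n)} (hB : B ⊆ S) :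
    sourceSet ε U u B = {x | ∃ Z ∈ B, x ∈ U ∧ Z ∈ S ∧ IsFocus ε U u x Z} := by
  ext x
  rw [mem_sourceSet]
  constructor
  · rintro ⟨hx, Z, hZ, h⟩; exact ⟨Z, hZ, hx, hB hZ, h⟩
  · rintro ⟨Z, hZ, hx, -, h⟩; exact ⟨hx, Z, hZ, h⟩

theorem refractorSet_inter_eq {n : ℕ} {ε : ℝ} {U : Set (Base n)} {S V : Set (Space n)}
    (hVS : V ⊆ S) {u : Base n → ℝ} {E : Set (Base n)} (hE : E ⊆ U) :
    refractorSet ε U S u E ∩ V =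
      {Z | ∃ x ∈ (Subtype.val ⁻¹' E : Set U), Z ∈ V ∧ IsFocus ε U u x Z} := by
  ext Z
  rw [mem_inter_iff, mem_refractorSet]
  constructor
  · rintro ⟨⟨-, x, hx, h⟩, hZ⟩; exact ⟨⟨x, hE hx⟩, hx, hZ, h⟩
  · rintro ⟨x, hx, hZ, h⟩; exact ⟨⟨hVS hZ, x, hx, h⟩, hZ⟩

theorem measurableSet_source_isCompact {n : ℕ} {ε : ℝ} (hε : 1 < ε) {U : Set (Base n)}
    (hUo : IsOpen U) (hUb : Bornology.IsBounded U) (hUn : U.Nonempty) {S : Set (Space n)}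
    (hS : IsClosed S) {m₀ : ℝ} {u : Base n → ℝ} (hc : ContinuousOn u U) (hs : InSlab U m₀ u)
    {K : Set (Space n)} (hK : IsCompact K) :
    MeasurableSet {x | ∃ Z ∈ K, x ∈ U ∧ Z ∈ S ∧ IsFocus ε U u x Z} := by
  have henv := (lipschitzWith_envelope hε hUb hUn hs).continuous
  have h1 : {x | ∃ Z ∈ K, x ∈ U ∧ Z ∈ S ∧ IsFocus ε U u x Z} =
      ⋃ j : ℕ, {x | x ∈ U ∧ ∃ Z ∈ K ∩ (S ∩ {Z | 1 / ((j : ℝ) + 1) ≤ envelope ε U u Z}),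
        axisThrough ε (pt x (u x)) Z - envelope ε U u Z ≤ 0} := by
    ext x
    simp only [mem_iUnion, mem_ofPred_eq]
    constructor
    · rintro ⟨Z, hZ, hx, hZS, hf⟩
      obtain ⟨h2, h3⟩ := (isFocus_iff_envelope hε hUb hUn hs hx).1 hf
      obtain ⟨j, hj⟩ := exists_nat_one_div_lt h2
      exact ⟨j, hx, Z, ⟨hZ, hZS, hj.le⟩, sub_nonpos.2 h3⟩
    · rintro ⟨j, hx, Z, ⟨hZ, hZS, hj⟩, h⟩
      refine ⟨Z, hZ, hx, hZS, (isFocus_iff_envelope hε hUb hUn hs hx).2 ⟨?_, sub_nonpos.1 h⟩⟩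
      exact lt_of_lt_of_le (by positivity) hj
  rw [h1]
  refine MeasurableSet.iUnion fun j => measurableSet_exists_le hUo.measurableSet
    (hK.inter_right (hS.inter (isClosed_le continuous_const henv))) ?_
  refine ContinuousOn.sub ?_ (henv.comp continuous_snd).continuousOn
  refine (continuous_axisThrough ε).comp_continuousOn (ContinuousOn.prodMk ?_ continuousOn_snd)
  refine continuous_pt.comp_continuousOn (continuousOn_fst.prodMk ?_)
  exact hc.comp continuousOn_fst fun q hq => hq.1

theorem measurableSet_refractor_isCompact {n : ℕ} {ε : ℝ} (hε : 1 < ε) {U : Set (Base n)}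
    (hUb : Bornology.IsBounded U) (hUn : U.Nonempty) {V : Set (Space n)} (hV : MeasurableSet V)
    {m₀ : ℝ} {u : Base n → ℝ} (hc : ContinuousOn u U) (hs : InSlab U m₀ u)
    {K : Set U} (hK : IsCompact K) :
    MeasurableSet {Z | ∃ x ∈ K, Z ∈ V ∧ IsFocus ε U u (x : Base n) Z} := by
  have henv := (lipschitzWith_envelope hε hUb hUn hs).continuous
  have h1 : {Z | ∃ x ∈ K, Z ∈ V ∧ IsFocus ε U u (x : Base n) Z} =
      {Z | 0 < envelope ε U u Z} ∩ {Z | Z ∈ V ∧ ∃ x ∈ K,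
        axisThrough ε (pt (x : Base n) (u x)) Z - envelope ε U u Z ≤ 0} := by
    ext Z
    simp only [mem_inter_iff, mem_ofPred_eq]
    constructor
    · rintro ⟨x, hx, hZ, hf⟩
      obtain ⟨h2, h3⟩ := (isFocus_iff_envelope hε hUb hUn hs x.2).1 hf
      exact ⟨h2, hZ, x, hx, sub_nonpos.2 h3⟩
    · rintro ⟨h2, hZ, x, hx, h3⟩
      exact ⟨x, hx, hZ, (isFocus_iff_envelope hε hUb hUn hs x.2).2 ⟨h2, sub_nonpos.1 h3⟩⟩
  rw [h1]
  refine (isOpen_lt continuous_const henv).measurableSet.inter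
    (measurableSet_exists_le hV hK (Continuous.continuousOn ?_))
  have hu : Continuous fun x : U => u x := continuousOn_iff_continuous_domRestrict.1 hc
  refine Continuous.sub ((continuous_axisThrough ε).comp (Continuous.prodMk ?_ continuous_fst))
    (henv.comp continuous_fst)
  exact continuous_pt.comp ((continuous_subtype_val.comp continuous_snd).prodMk
    (hu.comp continuous_snd))

theorem isClosed_receiver {n : ℕ} {ψ : Space n → ℝ} (hψ : ContDiff ℝ ∞ ψ) :
    IsClosed (receiver ψ) := isClosed_eq hψ.continuous continuous_const

theorem ae_source_unique {n : ℕ} {ε : ℝ} (hε : 1 < ε) {U : Set (Base n)} (hUo : IsOpen U)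
    {ψ : Space n → ℝ} (hψ : ContDiff ℝ ∞ ψ) {m₀ : ℝ} (hvis : Visible ψ U m₀)
    {V : Set (Space n)} {u : Base n → ℝ} (hu : Admissible ε U V u) (hs : InSlab U m₀ u) :
    ∀ᵐ x, ∀ Z₁ Z₂, (x ∈ U ∧ Z₁ ∈ receiver ψ ∧ IsFocus ε U u x Z₁) →
      (x ∈ U ∧ Z₂ ∈ receiver ψ ∧ IsFocus ε U u x Z₂) → Z₁ = Z₂ := by
  filter_upwards [ae_focus_unique hε hUo (hψ.differentiable (by simp)) hvis
    (hu.lipschitzOnWith hε) hs] with x hx Z₁ Z₂ h₁ h₂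
  exact hx h₁.1 Z₁ h₁.2.1 Z₂ h₂.2.1 h₁.2.2 h₂.2.2

theorem nullMeasurableSet_source {n : ℕ} {ε : ℝ} (hε : 1 < ε) {U : Set (Base n)}
    (hUo : IsOpen U) (hUb : Bornology.IsBounded U) (hUn : U.Nonempty) {ψ : Space n → ℝ}
    (hψ : ContDiff ℝ ∞ ψ) {m₀ : ℝ} (hvis : Visible ψ U m₀) {V : Set (Space n)}
    {u : Base n → ℝ} (hu : Admissible ε U V u) (hs : InSlab U m₀ u)
    {B : Set (Space n)} (hBS : B ⊆ receiver ψ) (hB : MeasurableSet B) :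
    NullMeasurableSet (sourceSet ε U u B) := by
  rw [sourceSet_eq hBS]
  exact nullMeasurableSet_exists (fun K hK =>
    (measurableSet_source_isCompact hε hUo hUb hUn (isClosed_receiver hψ)
      (hu.lipschitzOnWith hε).continuousOn hs hK).nullMeasurableSet)
    (ae_source_unique hε hUo hψ hvis hu hs) hB

theorem aedisjoint_source {n : ℕ} {ε : ℝ} (hε : 1 < ε) {U : Set (Base n)} (hUo : IsOpen U)
    {ψ : Space n → ℝ} (hψ : ContDiff ℝ ∞ ψ) {m₀ : ℝ} (hvis : Visible ψ U m₀)
    {V : Set (Space n)} {u : Base n → ℝ} (hu : Admissible ε U V u) (hs : InSlab U m₀ u)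
    {B C : Set (Space n)} (hB : B ⊆ receiver ψ) (hC : C ⊆ receiver ψ) (hBC : Disjoint B C) :
    AEDisjoint volume (sourceSet ε U u B) (sourceSet ε U u C) := by
  rw [sourceSet_eq hB, sourceSet_eq hC]
  exact aedisjoint_exists (ae_source_unique hε hUo hψ hvis hu hs) hBC

theorem ae_refractor_unique {n : ℕ} {ε : ℝ} (hε : 1 < ε) {U : Set (Base n)}
    (hUb : Bornology.IsBounded U) (hUn : U.Nonempty) {ψ : Space n → ℝ}
    (hψ : ContDiff ℝ ∞ ψ) {m₀ : ℝ} (hvis : Visible ψ U m₀) {V : Set (Space n)}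
    (hVS : V ⊆ receiver ψ) {u : Base n → ℝ} (hs : InSlab U m₀ u) :
    ∀ᵐ Z ∂(μHE[n] : Measure (Space n)), ∀ x y : U, (Z ∈ V ∧ IsFocus ε U u x Z) →
      (Z ∈ V ∧ IsFocus ε U u y Z) → x = y := by
  refine measure_mono_null ?_ (focus_double_null hε hUb hUn hψ hvis hs)
  intro Z hZ
  by_contra h
  refine hZ fun x y hx hy => ?_
  by_contra hxy
  exact h ⟨hVS hx.1, x, x.2, y, y.2, fun h' => hxy (Subtype.ext h'), hx.2, hy.2⟩

theorem nullMeasurableSet_refractor {n : ℕ} {ε : ℝ} (hε : 1 < ε) {U : Set (Base n)}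
    (hUo : IsOpen U) (hUb : Bornology.IsBounded U) (hUn : U.Nonempty) {ψ : Space n → ℝ}
    (hψ : ContDiff ℝ ∞ ψ) {m₀ : ℝ} (hvis : Visible ψ U m₀) {V : Set (Space n)}
    (hVS : V ⊆ receiver ψ) (hV : MeasurableSet V) {u : Base n → ℝ} (hc : ContinuousOn u U)
    (hs : InSlab U m₀ u) {E : Set (Base n)} (hE : E ⊆ U) (hEm : MeasurableSet E) :
    NullMeasurableSet (refractorSet ε U (receiver ψ) u E ∩ V) μHE[n] := by
  have : LocallyCompactSpace U := hUo.locallyCompactSpace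
  rw [refractorSet_inter_eq hVS hE]
  exact nullMeasurableSet_exists (fun K hK =>
    (measurableSet_refractor_isCompact hε hUb hUn hV hc hs hK).nullMeasurableSet)
    (ae_refractor_unique hε hUb hUn hψ hvis hVS hs) (measurable_subtype_coe hEm)

theorem alpha_iUnion {n : ℕ} {ε : ℝ} (hε : 1 < ε) {U : Set (Base n)}
    (hUo : IsOpen U) (hUb : Bornology.IsBounded U) (hUn : U.Nonempty) {ψ : Space n → ℝ}
    (hψ : ContDiff ℝ ∞ ψ) {m₀ : ℝ} (hvis : Visible ψ U m₀) {V : Set (Space n)}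
    (hVS : V ⊆ receiver ψ) (hV : MeasurableSet V) {u : Base n → ℝ} (hc : ContinuousOn u U)
    (hs : InSlab U m₀ u) (g : Space n → ℝ) {E : ℕ → Set (Base n)} (hE : ∀ i, E i ⊆ U)
    (hEm : ∀ i, MeasurableSet (E i)) (hd : Pairwise (Function.onFun Disjoint E)) :
    alpha ε U (receiver ψ) V u g (⋃ i, E i) = ∑' i, alpha ε U (receiver ψ) V u g (E i) := by
  have h1 : refractorSet ε U (receiver ψ) u (⋃ i, E i) ∩ V =
      ⋃ i, refractorSet ε U (receiver ψ) u (E i) ∩ V := by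
    ext Z
    simp only [mem_inter_iff, mem_refractorSet, mem_iUnion]
    tauto
  unfold alpha
  rw [h1]
  refine lintegral_iUnion₀ (fun i =>
    nullMeasurableSet_refractor hε hUo hUb hUn hψ hvis hVS hV hc hs (hE i) (hEm i)) ?_ _
  intro i j hij
  change AEDisjoint _ (refractorSet ε U (receiver ψ) u (E i) ∩ V)
    (refractorSet ε U (receiver ψ) u (E j) ∩ V)
  rw [refractorSet_inter_eq hVS (hE i), refractorSet_inter_eq hVS (hE j)]
  exact aedisjoint_exists (ae_refractor_unique hε hUb hUn hψ hvis hVS hs)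
    ((hd hij).preimage _)

/-! ### Solutions of type B are solutions of type A -/

/-- The energy balance of a solution of type B over a source set `E`: up to null sets, `E`
consists of the points refracted into `ℛ_u(E)`, since a null set of the target receives no
energy and almost every point of the target is lit from one point only. -/
theorem IsBType.lintegral_eq_alpha {n : ℕ} {ε : ℝ} (hε : 1 < ε) {U : Set (Base n)}
    (hUo : IsOpen U) (hUb : Bornology.IsBounded U) (hUn : U.Nonempty) {ψ : Space n → ℝ}
    (hψ : ContDiff ℝ ∞ ψ) {m₀ : ℝ} (hvis : Visible ψ U m₀) {V : Set (Space n)}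
    (hVS : V ⊆ receiver ψ) (hV : MeasurableSet V) {f : Base n → ℝ} {g : Space n → ℝ} {u : Base n → ℝ}
    (hu : IsBType ε U V f g u) (hs : InSlab U m₀ u) {E : Set (Base n)} (hE : E ⊆ U)
    (hEm : MeasurableSet E) :
    ∫⁻ x in E, ENNReal.ofReal (f x) = alpha ε U (receiver ψ) V u g E := by
  obtain ⟨hadm, hbal, -⟩ := hu
  have hR := nullMeasurableSet_refractor hε hUo hUb hUn hψ hvis hVS hV
    (hadm.lipschitzOnWith hε).continuousOn hs hE hEm
  set R := refractorSet ε U (receiver ψ) u E ∩ V with hRdef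
  obtain ⟨B, hBR, hBm, hBae⟩ := hR.exists_measurable_subset_ae_eq
  have hBV : B ⊆ V := hBR.trans inter_subset_right
  set D := {Z | Z ∈ receiver ψ ∧ ∃ x ∈ U, ∃ y ∈ U, x ≠ y ∧ IsFocus ε U u x Z ∧
      IsFocus ε U u y Z} with hD
  have hD0 : μHE[n] D = 0 := focus_double_null hε hUb hUn hψ hvis hs
  have hRB : μHE[n] (R \ B) = 0 := ae_le_set.1 hBae.symm.le
  set N := toMeasurable μHE[n] (R \ B ∪ D) ∩ V with hN
  have hNm : MeasurableSet N := (measurableSet_toMeasurable _ _).inter hV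
  have hNV : N ⊆ V := inter_subset_right
  have hN0 : μHE[n] N = 0 := by
    refine measure_mono_null inter_subset_left ?_
    rw [measure_toMeasurable]
    exact measure_union_null hRB hD0
  have hSN : ∫⁻ x in sourceSet ε U u N, ENNReal.ofReal (f x) = 0 := by
    have := hbal N hNV hNm
    rw [Measure.restrict_eq_zero.2 hN0, lintegral_zero_measure] at this
    exact this
  have hsub : ∀ C, sourceSet ε U u C ⊆ U := fun C x hx => hx.1
  have hSNm := nullMeasurableSet_source hε hUo hUb hUn hψ hvis hadm hs (hNV.trans hVS) hNm
  have hdiff : ∀ A : Set (Base n), ∫⁻ x in A, ENNReal.ofReal (f x) =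
      ∫⁻ x in A \ sourceSet ε U u N, ENNReal.ofReal (f x) := by
    intro A
    refine le_antisymm ?_ (lintegral_mono_set sdiff_subset)
    calc ∫⁻ x in A, ENNReal.ofReal (f x)
        ≤ ∫⁻ x in A \ sourceSet ε U u N ∪ sourceSet ε U u N, ENNReal.ofReal (f x) :=
          lintegral_mono_set (by rw [sdiff_union_self]; exact subset_union_left)
      _ ≤ _ := lintegral_union_le _ _ _
      _ = _ := by rw [hSN, add_zero]
  have hset : E \ sourceSet ε U u N = sourceSet ε U u B \ sourceSet ε U u N := by
    ext x
    constructor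
    · rintro ⟨hx, hxN⟩
      refine ⟨⟨hE hx, ?_⟩, hxN⟩
      obtain ⟨Z, hZ, hf⟩ := hadm x (hE hx)
      refine ⟨Z, ?_, hf⟩
      by_contra hZB
      refine hxN ⟨hE hx, Z, ⟨subset_toMeasurable _ _ (Or.inl ⟨⟨⟨hVS hZ, x, hx, hf⟩, hZ⟩, hZB⟩),
        hZ⟩, hf⟩
    · rintro ⟨⟨hxU, Z, hZ, hf⟩, hxN⟩
      refine ⟨?_, hxN⟩
      obtain ⟨⟨-, y, hy, hf'⟩, -⟩ := hBR hZ
      by_contra hxE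
      refine hxN ⟨hxU, Z, ⟨subset_toMeasurable _ _ (Or.inr ⟨hVS (hBV hZ), x, hxU, y, hE hy, ?_,
        hf, hf'⟩), hBV hZ⟩, hf⟩
      rintro rfl
      exact hxE hy
  have hBβ := hbal B hBV hBm
  unfold alpha
  rw [← hRdef, ← setLIntegral_congr hBae, ← hBβ, beta, hdiff E, hset, ← hdiff]

theorem IsBType.isAType {n : ℕ} {ε : ℝ} (hε : 1 < ε) {U : Set (Base n)}
    (hUo : IsOpen U) (hUb : Bornology.IsBounded U) (hUn : U.Nonempty) {ψ : Space n → ℝ}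
    (hψ : ContDiff ℝ ∞ ψ) {m₀ : ℝ} (hvis : Visible ψ U m₀) {V : Set (Space n)}
    (hV : IsTarget (receiver ψ) V) {f : Base n → ℝ} {g : Space n → ℝ}
    (hgm : AEMeasurable g (μHE[n].restrict V)) (hg : ∀ Z ∈ V, 0 < g Z) {u : Base n → ℝ}
    (hu : IsBType ε U V f g u) (hs : InSlab U m₀ u) :
    IsAType ε U (receiver ψ) V f g u := by
  obtain ⟨hVS, -, hVm, O, hO, -, hOV, hVO⟩ := hV
  refine ⟨hu.1, fun E hE hEm =>
    hu.lintegral_eq_alpha hε hUo hUb hUn hψ hvis hVS hVm hs hE hEm, ?_, ?_⟩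
  · refine closure_minimal (hVO.trans (closure_minimal ?_ isClosed_closure)) isClosed_closure
    intro Z hZ
    rw [mem_closure_iff]
    intro W hW hZW
    obtain ⟨x₀, hx₀⟩ := hUn
    have hBV : W ∩ O ∩ receiver ψ ⊆ V := fun Y hY => hOV ⟨hY.1.2, hY.2⟩
    have hBm : MeasurableSet (W ∩ O ∩ receiver ψ) :=
      (hW.inter hO).measurableSet.inter (isClosed_receiver hψ).measurableSet
    have hpos : 0 < μHE[n] (W ∩ O ∩ receiver ψ) :=
      euclideanHausdorff_pos (hψ.contDiffAt.hasStrictFDerivAt (by simp))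
        (hvis.fderiv_ne_zero (hs x₀ hx₀) hZ.2) (hW.inter hO) ⟨⟨hZW, hZ.1⟩, hZ.2⟩
    have hint : ∫⁻ Y in W ∩ O ∩ receiver ψ, ENNReal.ofReal (g Y) ∂μHE[n] ≠ 0 := by
      intro h0
      rw [lintegral_eq_zero_iff' (hgm.mono_measure (Measure.restrict_mono hBV le_rfl)).ennreal_ofReal,
        Filter.EventuallyEq, ae_restrict_iff' hBm] at h0
      refine hpos.ne' (measure_mono_null ?_ h0)
      intro Y hY h
      have := h hY
      rw [Pi.zero_apply, ENNReal.ofReal_eq_zero] at this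
      exact absurd (hg Y (hBV hY)) (not_lt.2 this)
    rw [← hu.2.1 _ hBV hBm] at hint
    have hne : (sourceSet ε U u (W ∩ O ∩ receiver ψ)).Nonempty := by
      by_contra h
      rw [not_nonempty_iff_eq_empty] at h
      exact hint (by rw [beta, h, Measure.restrict_empty, lintegral_zero_measure])
    obtain ⟨x, hx, Y, hY, hf⟩ := hne
    exact ⟨Y, hY.1.1, hY.2, x, hx, hf⟩
  · refine measure_mono_null ?_ (ae_source_unique hε hUo hψ hvis hu.1 hs)
    rintro x ⟨hx, hxV⟩ h
    obtain ⟨Z, hZ, hf⟩ := hu.1 x hx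
    refine hxV ?_
    rintro Y ⟨hYS, y, rfl, hf'⟩
    rw [h Y Z ⟨hx, hYS, hf'⟩ ⟨hx, hVS hZ, hf⟩]
    exact hZ

/-! ### The range of the semi-axes -/

theorem hyp_lt_hyp {n : ℕ} {ε a b : ℝ} (hε : 1 < ε) (ha : 0 < a) (hab : a < b) (x : Base n)
    (Z : Space n) : hyp ε x b Z < hyp ε x a Z := by
  have hb := ha.trans hab
  rw [hyp_eq ha, hyp_eq hb]
  have h1 : √(a ^ 2 + ‖x - proj Z‖ ^ 2 / (ε ^ 2 - 1)) ≤ √(b ^ 2 + ‖x - proj Z‖ ^ 2 / (ε ^ 2 - 1)) :=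
    Real.sqrt_le_sqrt (by gcongr)
  nlinarith

theorem hyp_anti {n : ℕ} {ε a b : ℝ} (hε : 1 < ε) (ha : 0 < a) (hab : a ≤ b) (x : Base n)
    (Z : Space n) : hyp ε x b Z ≤ hyp ε x a Z := by
  rcases hab.eq_or_lt with rfl | h
  · exact le_rfl
  · exact (hyp_lt_hyp hε ha h x Z).le

theorem continuousOn_hyp {n : ℕ} (ε : ℝ) (x : Base n) :
    ContinuousOn (fun q : ℝ × Space n => hyp ε x q.1 q.2) {q | 0 < q.1} := by
  have h : Continuous fun q : ℝ × Space n =>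
      height q.2 - q.1 * ε - √(q.1 ^ 2 + ‖x - proj q.2‖ ^ 2 / (ε ^ 2 - 1)) := by
    have h1 := continuous_height (n := n)
    have h2 := continuous_proj (n := n)
    fun_prop
  exact h.continuousOn.congr fun q hq => hyp_eq hq x q.2

theorem continuousAt_hyp {n : ℕ} (ε : ℝ) (x : Base n) {a : ℝ} (ha : 0 < a) (Z : Space n) :
    ContinuousAt (fun q : ℝ × Space n => hyp ε x q.1 q.2) (a, Z) :=
  (continuousOn_hyp ε x).continuousAt ((isOpen_lt continuous_const continuous_fst).mem_nhds ha)

theorem continuous_hyp_left {n : ℕ} (ε a : ℝ) (Z : Space n) :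
    Continuous fun x : Base n => hyp ε x a Z := by
  unfold hyp; fun_prop

theorem visRadius_spec {n : ℕ} {U : Set (Base n)} (hUb : Bornology.IsBounded U)
    (hUn : U.Nonempty) (z : Base n) :
    (∀ x ∈ closure U, dist x z ≤ visRadius U z) ∧ ∃ y ∈ closure U, dist y z = visRadius U z := by
  have hbdd : BddBelow {R : ℝ | 0 < R ∧ U ⊆ Metric.ball z R} := ⟨0, fun R hR => hR.1.le⟩
  have hne : {R : ℝ | 0 < R ∧ U ⊆ Metric.ball z R}.Nonempty := by
    obtain ⟨R, hR0, hR⟩ := hUb.subset_ball_lt 0 z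
    exact ⟨R, hR0, hR⟩
  have h1 : ∀ x ∈ closure U, dist x z ≤ visRadius U z := by
    intro x hx
    have : closure U ⊆ {x | dist x z ≤ visRadius U z} :=
      closure_minimal (fun x hx => le_csInf hne fun R hR => (hR.2 hx).le)
        (isClosed_le (by fun_prop) continuous_const)
    exact this hx
  refine ⟨h1, ?_⟩
  obtain ⟨y, hy, hmax⟩ := hUb.isCompact_closure.exists_isMaxOn hUn.closure
    (f := fun x => dist x z) (by fun_prop)
  refine ⟨y, hy, le_antisymm (h1 y hy) (le_of_forall_gt_imp_ge_of_dense fun R hR => ?_)⟩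
  refine csInf_le hbdd ⟨dist_nonneg.trans_lt hR, fun x hx => ?_⟩
  exact (hmax (subset_closure hx)).trans_lt hR

theorem exists_visRadius_lower {n : ℕ} (hn : 1 ≤ n) {U : Set (Base n)} (hUo : IsOpen U)
    (hUb : Bornology.IsBounded U) (hUn : U.Nonempty) : ∃ r > 0, ∀ z, r ≤ visRadius U z := by
  have : Nonempty (Fin n) := ⟨⟨0, hn⟩⟩
  obtain ⟨x, hx⟩ := hUn
  have hnt : U.Nontrivial := by
    by_contra h
    rw [not_nontrivial_iff] at h
    have h2 := h.eq_singleton_of_mem hx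
    rw [h2] at hUo
    exact not_isOpen_singleton x hUo
  obtain ⟨y, hy, hxy⟩ := hnt.exists_ne x
  refine ⟨dist x y / 2, half_pos (dist_pos.2 hxy.symm), fun z => ?_⟩
  have h1 := (visRadius_spec hUb ⟨x, hx⟩ z).1
  have h2 := h1 x (subset_closure hx)
  have h3 := h1 y (subset_closure hy)
  linarith [dist_triangle_right x y z]

theorem axisThrough_pt_zero {n : ℕ} (ε : ℝ) (x : Base n) (Z : Space n) :
    axisThrough ε (pt x 0) Z = ε * height Z - √(height Z ^ 2 + dist x (proj Z) ^ 2) := by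
  have h : dist (pt x 0) Z = √(height Z ^ 2 + dist x (proj Z) ^ 2) := by
    rw [← Real.sqrt_sq dist_nonneg, dist_pt_sq, sub_zero, dist_eq_norm x, add_comm]
  rw [axisThrough, height_pt, sub_zero, h]

theorem maxAxis_mul {n : ℕ} {ε : ℝ} (hε : 1 < ε) (U : Set (Base n)) (Z : Space n) :
    (ε ^ 2 - 1) * maxAxis ε U Z =
      ε * height Z - √(height Z ^ 2 + visRadius U (proj Z) ^ 2) := by
  have : ε ^ 2 - 1 ≠ 0 := by nlinarith
  rw [maxAxis]; field_simp

theorem inv_sqrt_lt {ε : ℝ} (hε : 1 < ε) : 1 / √(ε ^ 2 - 1) < 1 / (ε - 1) := by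
  refine one_div_lt_one_div_of_lt (by linarith) ?_
  exact Real.lt_sqrt_of_sq_lt (by nlinarith)

theorem maxAxis_pos {n : ℕ} {ε : ℝ} (hε : 1 < ε) {U : Set (Base n)} {Z : Space n}
    (hρ : 0 < visRadius U (proj Z))
    (h : (2 / (ε - 1) + 1 / √(ε ^ 2 - 1)) * visRadius U (proj Z) ≤ height Z) :
    0 < maxAxis ε U Z := by
  have he : 0 < ε ^ 2 - 1 := by nlinarith
  have hs : 0 < √(ε ^ 2 - 1) := Real.sqrt_pos.2 he
  have hs2 := Real.sq_sqrt he.le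
  have h1 : visRadius U (proj Z) / √(ε ^ 2 - 1) < height Z := by
    refine lt_of_lt_of_le ?_ h
    have : 0 < 2 / (ε - 1) := div_pos two_pos (by linarith)
    rw [div_eq_mul_one_div, mul_comm]
    nlinarith
  rw [div_lt_iff₀ hs] at h1
  have hh : 0 < height Z := by
    by_contra! hc
    nlinarith
  have h2 : √(height Z ^ 2 + visRadius U (proj Z) ^ 2) < ε * height Z := by
    rw [Real.sqrt_lt' (by positivity)]
    have : visRadius U (proj Z) ^ 2 < (height Z * √(ε ^ 2 - 1)) ^ 2 := by gcongr
    rw [mul_pow, hs2] at this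
    nlinarith
  refine div_pos ?_ he
  linarith

theorem hyp_nonneg {n : ℕ} {ε : ℝ} (hε : 1 < ε) {U : Set (Base n)}
    (hUb : Bornology.IsBounded U) {Z : Space n} {a : ℝ} (ha : 0 < a) (haZ : a ≤ maxAxis ε U Z)
    {x : Base n} (hx : x ∈ U) : 0 ≤ hyp ε x a Z := by
  have he : 0 < ε ^ 2 - 1 := by nlinarith
  rw [le_hyp_iff hε ha, axisThrough_pt_zero]
  refine (mul_le_mul_of_nonneg_left haZ he.le).trans ?_
  rw [maxAxis_mul hε]
  have := (visRadius_spec hUb ⟨x, hx⟩ (proj Z)).1 x (subset_closure hx)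
  gcongr

/-- The hyperboloid of maximal semi-axis comes down to level `0` on the closure of `U`. -/
theorem exists_hyp_maxAxis_eq_zero {n : ℕ} {ε : ℝ} (hε : 1 < ε) {U : Set (Base n)}
    (hUb : Bornology.IsBounded U) (hUn : U.Nonempty) {Z : Space n} (hZ : 0 < maxAxis ε U Z) :
    ∃ y ∈ closure U, hyp ε y (maxAxis ε U Z) Z = 0 := by
  obtain ⟨y, hy, h⟩ := (visRadius_spec hUb hUn (proj Z)).2
  refine ⟨y, hy, ?_⟩
  rw [hyp_eq_iff hε hZ, axisThrough_pt_zero, h, maxAxis_mul hε]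

/-- Under the span condition, a hyperboloid of sufficiently small semi-axis lies above all
hyperboloids of maximal semi-axis. -/
theorem exists_small_axis {n : ℕ} (hn : 1 ≤ n) {ε : ℝ} (hε : 1 < ε) {U : Set (Base n)}
    (hUo : IsOpen U) (hUb : Bornology.IsBounded U) (hUn : U.Nonempty) {V : Set (Space n)}
    (hS : SpanCondition ε U V) :
    ∃ δ > 0, ∀ Z ∈ V, ∀ Z' ∈ V, ∀ x ∈ U,
      hyp ε x (maxAxis ε U Z') Z' < hyp ε x δ Z := by
  have he : 0 < ε ^ 2 - 1 := by nlinarith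
  have hs : 0 < √(ε ^ 2 - 1) := Real.sqrt_pos.2 he
  obtain ⟨r, hr, hrV⟩ := exists_visRadius_lower hn hUo hUb hUn
  have hgap := sub_pos.2 (inv_sqrt_lt hε)
  set c := 1 / (ε - 1) - 1 / √(ε ^ 2 - 1) with hc
  have hδ : 0 < r * c / (ε + 1) := by positivity
  refine ⟨r * c / (ε + 1), hδ, fun Z hZ Z' hZ' x hx => ?_⟩
  set δ := r * c / (ε + 1) with hδdef
  have hδ' : δ * (ε + 1) = r * c := by rw [hδdef]; field_simp
  have hρ' := hr.trans_le (hrV (proj Z'))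
  have hρ := hrV (proj Z)
  have hA := maxAxis_pos hε hρ' (hS Z' hZ')
  obtain ⟨y, hy, hy0⟩ := exists_hyp_maxAxis_eq_zero hε hUb hUn hA
  obtain ⟨hvis, -⟩ := visRadius_spec hUb hUn (proj Z)
  have h1 := hyp_sub_le hε hA x y Z'
  rw [hy0, zero_add] at h1
  have h2 : dist x y ≤ 2 * visRadius U (proj Z) := by
    linarith [dist_triangle_right x y (proj Z), hvis x (subset_closure hx), hvis y hy]
  have h3 : √(δ ^ 2 + ‖x - proj Z‖ ^ 2 / (ε ^ 2 - 1)) ≤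
      δ + 1 / √(ε ^ 2 - 1) * visRadius U (proj Z) := by
    have h4 : ‖x - proj Z‖ ^ 2 / (ε ^ 2 - 1) = (‖x - proj Z‖ / √(ε ^ 2 - 1)) ^ 2 := by
      rw [div_pow, Real.sq_sqrt he.le]
    have h5 := sqrt_sq_add_sq_le δ (‖x - proj Z‖ / √(ε ^ 2 - 1)) 0
    rw [zero_pow two_ne_zero, add_zero, Real.sqrt_sq hδ.le, sub_zero,
      abs_of_nonneg (by positivity)] at h5
    rw [h4]
    refine h5.trans ?_
    rw [div_eq_mul_one_div, mul_comm]
    have := hvis x (subset_closure hx)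
    rw [dist_eq_norm] at this
    gcongr
  have h6 := hS Z hZ
  rw [hyp_eq hδ]
  have h7 : 1 / √(ε ^ 2 - 1) * dist x y ≤ 1 / √(ε ^ 2 - 1) * (2 * visRadius U (proj Z)) := by
    gcongr
  have h8 : (2 / (ε - 1) + 1 / √(ε ^ 2 - 1)) * visRadius U (proj Z) =
      2 * (c * visRadius U (proj Z)) + 3 * (1 / √(ε ^ 2 - 1) * visRadius U (proj Z)) := by
    rw [hc]; ring
  have h9 : r * c ≤ c * visRadius U (proj Z) := by rw [mul_comm r]; gcongr
  have h10 : 0 < r * c := by positivity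
  nlinarith

theorem exists_maxAxis_le {n : ℕ} {ε : ℝ} (hε : 1 < ε) {U : Set (Base n)} {V : Set (Space n)}
    (hV : Bornology.IsBounded V) : ∃ A, ∀ Z ∈ V, maxAxis ε U Z ≤ A := by
  have he : 0 < ε ^ 2 - 1 := by nlinarith
  obtain ⟨R, hR⟩ := hV.subset_closedBall 0
  refine ⟨ε * R / (ε ^ 2 - 1), fun Z hZ => ?_⟩
  have h1 : ‖Z‖ ≤ R := mem_closedBall_zero_iff.1 (hR hZ)
  have h2 := (le_abs_self _).trans (height_le_norm Z)
  unfold maxAxis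
  gcongr
  nlinarith [Real.sqrt_nonneg (height Z ^ 2 + visRadius U (proj Z) ^ 2)]

/-! ### Discrete targets -/

/-- A Fatou lemma for sets: if `T` contains all points lying in infinitely many `S k`, a lower
bound for the measures of the `S k` is one for the measure of `T`. -/
theorem le_measure_of_frequently {α : Type*} [MeasurableSpace α] {ν : Measure α}
    [IsFiniteMeasure ν] {S : ℕ → Set α} (hS : ∀ k, MeasurableSet (S k)) {T : Set α} {c : ℝ≥0∞}
    (hc : ∀ k, c ≤ ν (S k)) (hT : ∀ x, (∃ᶠ k in atTop, x ∈ S k) → x ∈ T) : c ≤ ν T := by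
  have h1 : (⋂ N : ℕ, ⋃ k ≥ N, S k) ⊆ T := by
    intro x hx
    refine hT x (frequently_atTop.2 fun N => ?_)
    have := mem_iInter.1 hx N
    simp only [mem_iUnion, exists_prop] at this
    exact this
  refine le_trans ?_ (measure_mono h1)
  rw [Antitone.measure_iInter]
  · exact le_iInf fun N => (hc N).trans (measure_mono
      (subset_iUnion₂ (s := fun k (_ : k ≥ N) => S k) N le_rfl))
  · intro M N hMN
    exact biUnion_subset_biUnion_left fun k hk => le_trans hMN hk
  · exact fun N => (MeasurableSet.biUnion (to_countable _) fun k _ => hS k).nullMeasurableSet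
  · exact ⟨0, measure_ne_top _ _⟩

/-- The part of `U` over which the `i`-th of finitely many hyperboloids is the lowest. -/
def piece {n : ℕ} {ι : Type*} (ε : ℝ) (U : Set (Base n)) (Z : ι → Space n) (a : ι → ℝ) (i : ι) :
    Set (Base n) :=
  {x | x ∈ U ∧ ∀ j, hyp ε x (a i) (Z i) ≤ hyp ε x (a j) (Z j)}

theorem measurableSet_piece {n : ℕ} {ι : Type*} (ε : ℝ) {U : Set (Base n)} (hU : IsOpen U)
    (Z : ι → Space n) (a : ι → ℝ) (i : ι) : MeasurableSet (piece ε U Z a i) := by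
  have : piece ε U Z a i = U ∩ ⋂ j, {x | hyp ε x (a i) (Z i) ≤ hyp ε x (a j) (Z j)} := by
    ext x; simp [piece]
  rw [this]
  exact hU.measurableSet.inter (isClosed_iInter fun j =>
    isClosed_le (continuous_hyp_left _ _ _) (continuous_hyp_left _ _ _)).measurableSet

theorem iUnion_piece {n : ℕ} {ι : Type*} [Finite ι] [Nonempty ι] (ε : ℝ) (U : Set (Base n))
    (Z : ι → Space n) (a : ι → ℝ) : ⋃ i, piece ε U Z a i = U := by
  ext x
  simp only [mem_iUnion]
  constructor
  · rintro ⟨i, hi⟩; exact hi.1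
  · intro hx
    obtain ⟨i, hi⟩ := Finite.exists_min fun i => hyp ε x (a i) (Z i)
    exact ⟨i, hx, hi⟩

/-- The refractor surface of finitely many hyperboloids. -/
noncomputable def lowest {n : ℕ} {ι : Type*} (ε : ℝ) (Z : ι → Space n) (a : ι → ℝ) (x : Base n) :
    ℝ :=
  ⨅ i, hyp ε x (a i) (Z i)

theorem lowest_le {n : ℕ} {ι : Type*} [Finite ι] (ε : ℝ) (Z : ι → Space n) (a : ι → ℝ)
    (x : Base n) (i : ι) : lowest ε Z a x ≤ hyp ε x (a i) (Z i) :=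
  ciInf_le (finite_range _).bddBelow i

theorem supports_of_mem_piece {n : ℕ} {ι : Type*} [Finite ι] {ε : ℝ} {U : Set (Base n)}
    {Z : ι → Space n} {a : ι → ℝ} {i : ι} (ha : 0 < a i) {x : Base n}
    (hx : x ∈ piece ε U Z a i) : Supports ε U (lowest ε Z a) x (a i) (Z i) := by
  have : Nonempty ι := ⟨i⟩
  exact ⟨ha, le_antisymm (le_ciInf hx.2) (lowest_le ε Z a x i), fun y _ => lowest_le ε Z a y i⟩

theorem continuousAt_hyp_axis {n : ℕ} (ε : ℝ) (x : Base n) (Z : Space n) {a : ℝ} (ha : 0 < a) :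
    ContinuousAt (fun a => hyp ε x a Z) a :=
  (continuousAt_hyp ε x ha Z).comp (f := fun a => (a, Z)) (by fun_prop)

/-- Energies of the pieces are upper semicontinuous in the semi-axes. -/
theorem isClosed_le_piece {n : ℕ} {ι : Type*} [Finite ι] {ε : ℝ} {U : Set (Base n)}
    (hU : IsOpen U) {ν : Measure (Base n)} [IsFiniteMeasure ν] {Z : ι → Space n} {A : ι → ℝ}
    {δ : ℝ} (hδ : 0 < δ) (c : ℝ≥0∞) (i : ι) :
    IsClosed {a : ι → ℝ | a ∈ Icc (fun _ => δ) A ∧ c ≤ ν (piece ε U Z a i)} := by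
  refine IsSeqClosed.isClosed fun a b ha hab => ?_
  have hb : b ∈ Icc (fun _ => δ) A := isClosed_Icc.mem_of_tendsto hab
    (Eventually.of_forall fun k => (ha k).1)
  refine ⟨hb, le_measure_of_frequently (fun k => measurableSet_piece ε hU Z (a k) i)
    (fun k => (ha k).2) fun x hx => ?_⟩
  have hlim : ∀ j, Tendsto (fun k => hyp ε x (a k j) (Z j)) atTop (𝓝 (hyp ε x (b j) (Z j))) :=
    fun j => (continuousAt_hyp_axis ε x (Z j) (hδ.trans_le (hb.1 j))).tendsto.comp
      ((continuous_apply j).continuousAt.tendsto.comp hab)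
  obtain ⟨k, hk⟩ := hx.exists
  refine ⟨hk.1, fun j => ?_⟩
  by_contra! h
  exact hx (((hlim j).eventually_lt (hlim i) h).mono fun k hk h' => not_lt.2 (h'.2 j) hk)

/-- If the total energies agree and overlaps of pieces carry no energy, the energy of no
piece exceeds its prescribed value for suitable semi-axes, one of which is maximal.
The semi-axes minimize their sum among those for which only pieces with maximal semi-axis
receive too little. -/
theorem exists_discrete {n : ℕ} {ι : Type*} [Fintype ι] [Nonempty ι] {ε : ℝ} (hε : 1 < ε)
    {U : Set (Base n)} (hU : IsOpen U) {ν : Measure (Base n)} [IsFiniteMeasure ν]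
    (hνU : ν Uᶜ = 0) {Z : ι → Space n} {A : ι → ℝ} {δ : ℝ} (hδ : 0 < δ) (hδA : ∀ i, δ ≤ A i)
    (hlow : ∀ i j, ∀ x ∈ U, hyp ε x (A j) (Z j) < hyp ε x δ (Z i))
    (hnull : ∀ a ∈ Icc (fun _ => δ) A, (∃ j, a j = A j) → ∀ i j, i ≠ j →
      ν (piece ε U Z a i ∩ piece ε U Z a j) = 0)
    {m : ι → ℝ≥0∞} (hm : ∑ i, m i = ν univ) :
    ∃ a ∈ Icc (fun _ => δ) A, (∃ j, a j = A j) ∧ ∀ i, ν (piece ε U Z a i) ≤ m i := by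
  classical
  have hsum : ∀ a ∈ Icc (fun _ => δ) A, (∃ j, a j = A j) → ∑ i, ν (piece ε U Z a i) = ∑ i, m i := by
    intro a ha hj
    rw [hm, ← tsum_fintype (L := SummationFilter.unconditional ι),
      ← measure_iUnion₀ (fun i j hij => hnull a ha hj i j hij)
      fun i => (measurableSet_piece ε hU Z a i).nullMeasurableSet, iUnion_piece]
    exact measure_of_measure_compl_eq_zero hνU
  have hmfin : ∀ i, m i ≠ ⊤ := fun i => by
    refine ne_top_of_le_ne_top (measure_ne_top ν univ) ?_
    rw [← hm]; exact Finset.single_le_sum (fun _ _ => zero_le) (Finset.mem_univ i)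
  set C : Set (ι → ℝ) := (Icc (fun _ => δ) A ∩ ⋃ j, {a | a j = A j}) ∩
    ⋂ i, ({a | A i ≤ a i} ∪ {a | a ∈ Icc (fun _ => δ) A ∧ m i ≤ ν (piece ε U Z a i)}) with hC
  have hCc : IsCompact C := by
    refine (isCompact_Icc.inter_right (isClosed_iUnion_of_finite fun j =>
      isClosed_eq (continuous_apply j) continuous_const)).inter_right
      (isClosed_iInter fun i => ?_)
    exact (isClosed_le continuous_const (continuous_apply i)).union (isClosed_le_piece hU hδ _ _)
  have hCn : A ∈ C := by
    refine ⟨⟨⟨hδA, le_rfl⟩, mem_iUnion.2 ⟨Classical.arbitrary ι, rfl⟩⟩, ?_⟩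
    exact mem_iInter.2 fun i => Or.inl (le_refl (A i))
  obtain ⟨a, ha, hmin⟩ := hCc.exists_isMinOn ⟨A, hCn⟩ (f := fun a => ∑ i, a i)
    (by fun_prop)
  obtain ⟨⟨haI, haj⟩, haD⟩ := ha
  obtain ⟨j, hj⟩ := mem_iUnion.1 haj
  have haD' : ∀ i, a i < A i → m i ≤ ν (piece ε U Z a i) := fun i hi =>
    ((mem_iInter.1 haD i).resolve_left (not_le.2 hi)).2
  refine ⟨a, haI, ⟨j, hj⟩, fun i => ?_⟩
  by_contra! hi
  have hδi : δ < a i := by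
    refine lt_of_le_of_ne (haI.1 i) fun h => ?_
    have : piece ε U Z a i = ∅ := by
      refine eq_empty_of_forall_notMem fun x hx => ?_
      have h1 := hx.2 j
      have hj' : a j = A j := hj
      rw [← h, hj'] at h1
      exact not_lt.2 h1 (hlow i j x hx.1)
    rw [this, measure_empty] at hi
    exact not_lt_zero hi
  -- the `i`-th piece for semi-axes increasing to `a i`
  set t : ℕ → ℝ := fun k => a i - (a i - δ) / (k + 1) with ht
  have htlt : ∀ k, t k < a i := fun k => by
    have : 0 < (a i - δ) / ((k : ℝ) + 1) := div_pos (sub_pos.2 hδi) (by positivity)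
    simp only [ht]; linarith
  have htδ : ∀ k, δ ≤ t k := fun k => by
    have : (a i - δ) / ((k : ℝ) + 1) ≤ a i - δ := by
      apply div_le_self (sub_pos.2 hδi).le
      have : (0 : ℝ) ≤ k := Nat.cast_nonneg k
      linarith
    simp only [ht]; linarith
  have htmono : Monotone t := fun k l hkl => by
    have h1 : (k : ℝ) ≤ l := Nat.cast_le.2 hkl
    have h2 : (a i - δ) / ((l : ℝ) + 1) ≤ (a i - δ) / ((k : ℝ) + 1) := by
      have := (sub_pos.2 hδi).le
      gcongr
    simp only [ht]; linarith
  have htlim : Tendsto t atTop (𝓝 (a i)) := by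
    have h1 := (tendsto_one_div_add_atTop_nhds_zero_nat (𝕜 := ℝ)).const_mul (a i - δ)
    have h2 := h1.const_sub (a i)
    rw [mul_zero, sub_zero] at h2
    refine h2.congr fun k => ?_
    simp only [ht]; ring
  have hpi : ∀ k, piece ε U Z (Function.update a i (t k)) i =
      {x | x ∈ U ∧ ∀ l, l ≠ i → hyp ε x (t k) (Z i) ≤ hyp ε x (a l) (Z l)} := by
    intro k; ext x
    simp only [piece, mem_ofPred_eq, Function.update_self]
    refine and_congr_right fun _ => forall_congr' fun l => ?_
    by_cases hl : l = i
    · subst hl; simp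
    · simp [hl]
  have hmono : Monotone fun k => piece ε U Z (Function.update a i (t k)) i := by
    intro k l hkl x hx
    simp only [hpi] at hx ⊢
    exact ⟨hx.1, fun p hp => (hyp_anti hε (hδ.trans_le (htδ k)) (htmono hkl) x _).trans
      (hx.2 p hp)⟩
  have hcov : piece ε U Z a i ⊆ (⋃ k, piece ε U Z (Function.update a i (t k)) i) ∪
      ⋃ l ∈ {l | l ≠ i}, piece ε U Z a i ∩ piece ε U Z a l := by
    intro x hx
    by_cases h : ∃ l, l ≠ i ∧ hyp ε x (a i) (Z i) = hyp ε x (a l) (Z l)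
    · obtain ⟨l, hl, he⟩ := h
      exact Or.inr (mem_biUnion (show l ∈ {l | l ≠ i} from hl) ⟨hx, hx.1, fun p => he ▸ hx.2 p⟩)
    · left
      push Not at h
      have hev : ∀ᶠ k in atTop, ∀ l, l ≠ i → hyp ε x (t k) (Z i) ≤ hyp ε x (a l) (Z l) := by
        rw [eventually_all]
        intro l
        by_cases hl : l = i
        · exact Eventually.of_forall fun _ h => absurd hl h
        have h1 := ((continuousAt_hyp_axis ε x (Z i) (hδ.trans hδi)).tendsto.comp
          htlim).eventually_lt_const (lt_of_le_of_ne (hx.2 l) (h l hl))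
        exact h1.mono fun k hk _ => hk.le
      obtain ⟨k, hk⟩ := hev.exists
      exact mem_iUnion.2 ⟨k, by rw [hpi]; exact ⟨hx.1, hk⟩⟩
  have hlt : m i < ν (⋃ k, piece ε U Z (Function.update a i (t k)) i) := by
    refine hi.trans_le ((measure_mono hcov).trans ((measure_union_le _ _).trans ?_))
    have h0 : ν (⋃ l ∈ {l | l ≠ i}, piece ε U Z a i ∩ piece ε U Z a l) = 0 :=
      (measure_biUnion_null_iff (to_countable _)).2 fun l hl =>
        hnull a haI ⟨j, hj⟩ i l (Ne.symm hl)
    rw [h0, add_zero]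
  rw [hmono.measure_iUnion, lt_iSup_iff] at hlt
  obtain ⟨k, hk⟩ := hlt
  set b := Function.update a i (t k) with hb
  have hbi : b i = t k := Function.update_self ..
  have hbj : ∀ l, l ≠ i → b l = a l := fun l hl => Function.update_of_ne hl ..
  have hbI : b ∈ Icc (fun _ => δ) A := by
    refine ⟨fun l => ?_, fun l => ?_⟩ <;> by_cases hl : l = i
    · subst hl; rw [hbi]; exact htδ k
    · rw [hbj l hl]; exact haI.1 l
    · subst hl; rw [hbi]; exact (htlt k).le.trans (haI.2 l)
    · rw [hbj l hl]; exact haI.2 l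
  -- some other semi-axis is maximal, for otherwise the total energy would be too large
  obtain ⟨l, hli, hl⟩ : ∃ l, l ≠ i ∧ a l = A l := by
    by_contra! h
    have h1 : ∀ l ∈ Finset.univ.erase i, m l ≤ ν (piece ε U Z a l) := fun l hl =>
      haD' l (lt_of_le_of_ne (haI.2 l) (h l (Finset.ne_of_mem_erase hl)))
    have h2 := ENNReal.add_lt_add_of_lt_of_le
      (ENNReal.sum_ne_top.2 fun l _ => hmfin l) hi (Finset.sum_le_sum h1)
    rw [Finset.add_sum_erase _ _ (Finset.mem_univ i),
      Finset.add_sum_erase _ (fun l => ν (piece ε U Z a l)) (Finset.mem_univ i),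
      hsum a haI ⟨j, hj⟩] at h2
    exact lt_irrefl _ h2
  have hbC : b ∈ C := by
    refine ⟨⟨hbI, mem_iUnion.2 ⟨l, (hbj l hli).trans hl⟩⟩, mem_iInter.2 fun p => ?_⟩
    by_cases hp : p = i
    · subst hp; exact Or.inr ⟨hbI, hk.le⟩
    · rcases (haI.2 p).lt_or_eq with h | h
      · refine Or.inr ⟨hbI, (haD' p h).trans (measure_mono fun x hx => ⟨hx.1, fun q => ?_⟩)⟩
        rw [hbj p hp]
        by_cases hq : q = i
        · subst hq; rw [hbi]
          exact (hx.2 q).trans (hyp_anti hε (hδ.trans_le (htδ k)) (htlt k).le x _)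
        · rw [hbj q hq]; exact hx.2 q
      · left
        change A p ≤ b p
        rw [hbj p hp, h]
  have hle : ∑ p, a p ≤ ∑ p, b p := hmin hbC
  have hlt' : ∑ p, b p < ∑ p, a p := by
    refine Finset.sum_lt_sum (fun p _ => ?_) ⟨i, Finset.mem_univ i, by rw [hbi]; exact htlt k⟩
    by_cases hp : p = i
    · subst hp; rw [hbi]; exact (htlt k).le
    · rw [hbj p hp]
  exact not_lt.2 hle hlt'

/-! ### Approximation and passage to the limit -/

theorem exists_simpleFunc_near {X : Type*} [MetricSpace X] [SecondCountableTopology X]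
    [MeasurableSpace X] [BorelSpace X]
    {V : Set X} (hV : IsCompact V) (hVn : V.Nonempty) {r : ℝ} (hr : 0 < r) :
    ∃ T : SimpleFunc X X, (∀ Z, T Z ∈ V) ∧ ∀ Z ∈ V, dist (T Z) Z ≤ r := by
  have := hVn.to_subtype
  set e : ℕ → X := fun k => (TopologicalSpace.denseSeq V k : X) with he
  have hcov : V ⊆ ⋃ N : ℕ, ⋃ k ≤ N, Metric.ball (e k) r := by
    intro Z hZ
    obtain ⟨k, hk⟩ := (TopologicalSpace.denseRange_denseSeq V).exists_dist_lt (⟨Z, hZ⟩ : V) hr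
    exact mem_iUnion.2 ⟨k, mem_biUnion (le_refl k) hk⟩
  obtain ⟨N, hN⟩ := hV.elim_directed_cover _ (fun N => isOpen_biUnion fun k _ => Metric.isOpen_ball)
    hcov (Monotone.directed_le fun M N hMN =>
      biUnion_subset_biUnion_left fun k hk => le_trans hk hMN)
  refine ⟨SimpleFunc.nearestPt e N, fun Z => Subtype.coe_prop _, fun Z hZ => ?_⟩
  obtain ⟨k, hk, hZk⟩ := mem_iUnion₂.1 (hN hZ)
  have h1 := SimpleFunc.edist_nearestPt_le e Z hk
  rw [edist_dist, edist_dist, ENNReal.ofReal_le_ofReal_iff dist_nonneg] at h1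
  rw [Metric.mem_ball'] at hZk
  exact h1.trans hZk.le

/-- A surface made of finitely many hyperboloids, whose energies approximate the measure `μ`
at scale `r`: the points refracted into the `r`-neighbourhood of a set `K` carry at least the
energy `μ K`. -/
theorem exists_approximate {n : ℕ} {ε : ℝ} (hε : 1 < ε) {U : Set (Base n)} (hUo : IsOpen U)
    (hUb : Bornology.IsBounded U) {ψ : Space n → ℝ} (hψ : ContDiff ℝ ∞ ψ)
    {m₀ : ℝ} (hvis : Visible ψ U m₀) {V : Set (Space n)} (hVS : V ⊆ receiver ψ)
    (hVc : IsCompact V) (hVn : V.Nonempty) (hL : AboveMaxLevel ε U V m₀)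
    {δ : ℝ} (hδ : 0 < δ) (hδV : ∀ Z ∈ V, ∀ Z' ∈ V, ∀ x ∈ U,
      hyp ε x (maxAxis ε U Z') Z' < hyp ε x δ Z)
    (hδA : ∀ Z ∈ V, δ ≤ maxAxis ε U Z) {A : ℝ} (hA : ∀ Z ∈ V, maxAxis ε U Z ≤ A)
    {ν : Measure (Base n)} [IsFiniteMeasure ν] (hν : ν ≪ volume) (hνU : ν Uᶜ = 0)
    {μ : Measure (Space n)} (hμν : μ univ = ν univ) {r : ℝ} (hr : 0 < r) :
    ∃ w : Base n → ℝ, InSlab U m₀ w ∧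
      (∀ x ∈ U, ∃ Z ∈ V, ∃ a ∈ Icc δ A, Supports ε U w x a Z) ∧
      ∀ K : Set (Space n), MeasurableSet K → K ⊆ V →
        ∃ Q : Set (Base n), MeasurableSet Q ∧ μ K ≤ ν Q ∧ ∀ x ∈ Q,
          ∃ Z ∈ V, Metric.infDist Z K ≤ r ∧ ∃ a ∈ Icc δ A, Supports ε U w x a Z := by
  classical
  obtain ⟨T, hTV, hT⟩ := exists_simpleFunc_near hVc hVn hr
  have hne : Nonempty T.range := by
    obtain ⟨Z, -⟩ := hVn
    exact ⟨⟨T Z, SimpleFunc.mem_range_self T Z⟩⟩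
  have hmem : ∀ i : T.range, (i : Space n) ∈ V := fun i => by
    obtain ⟨Z, hZ⟩ := SimpleFunc.mem_range.1 i.2
    exact hZ ▸ hTV Z
  set Z : T.range → Space n := fun i => i with hZdef
  have hslab : ∀ a ∈ Icc (fun _ => δ) (fun i => maxAxis ε U (Z i)),
      (∃ j, a j = maxAxis ε U (Z j)) → InSlab U m₀ (lowest ε Z a) := by
    rintro a ha ⟨j, hj⟩ x hx
    refine ⟨by rwa [proj_pt], ?_⟩
    rw [height_pt]
    refine ⟨le_ciInf fun i => hyp_nonneg hε hUb (hδ.trans_le (ha.1 i)) (ha.2 i) hx, ?_⟩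
    refine (lowest_le ε Z a x j).trans ?_
    rw [hj]
    exact hL x hx _ (hmem j)
  have hsupp : ∀ a ∈ Icc (fun _ => δ) (fun i => maxAxis ε U (Z i)), ∀ i,
      ∀ x ∈ piece ε U Z a i, Supports ε U (lowest ε Z a) x (a i) (Z i) := fun a ha i x hx =>
    supports_of_mem_piece (hδ.trans_le (ha.1 i)) hx
  have hcov : ∀ a : T.range → ℝ, ∀ x ∈ U, ∃ i, x ∈ piece ε U Z a i := fun a x hx => by
    rwa [← iUnion_piece ε U Z a, mem_iUnion] at hx
  have hnull : ∀ a ∈ Icc (fun _ => δ) (fun i => maxAxis ε U (Z i)),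
      (∃ j, a j = maxAxis ε U (Z j)) → ∀ i j, i ≠ j →
      ν (piece ε U Z a i ∩ piece ε U Z a j) = 0 := by
    intro a ha hj i j hij
    have hadm : Admissible ε U V (lowest ε Z a) := fun x hx => by
      obtain ⟨i, hi⟩ := hcov a x hx
      exact ⟨Z i, hmem i, a i, hsupp a ha i x hi⟩
    refine hν (measure_mono_null ?_ (ae_source_unique hε hUo hψ hvis hadm (hslab a ha hj)))
    rintro x ⟨hxi, hxj⟩ h
    exact hij (Subtype.ext (h (Z i) (Z j) ⟨hxi.1, hVS (hmem i), a i, hsupp a ha i x hxi⟩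
      ⟨hxi.1, hVS (hmem j), a j, hsupp a ha j x hxj⟩))
  have hm : ∑ i : T.range, μ (T ⁻¹' {(i : Space n)}) = ν univ := by
    rw [Finset.sum_coe_sort T.range fun y => μ (T ⁻¹' {y}),
      sum_measure_preimage_singleton _ fun y _ => T.measurableSet_fiber y, ← hμν]
    congr 1
    ext Y; simp
  obtain ⟨a, ha, hj, hle⟩ := exists_discrete hε hUo hνU hδ (fun i => hδA _ (hmem i))
    (fun i j x hx => hδV _ (hmem i) _ (hmem j) x hx) hnull hm
  refine ⟨lowest ε Z a, hslab a ha hj, fun x hx => ?_, fun K hK hKV => ?_⟩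
  · obtain ⟨i, hi⟩ := hcov a x hx
    exact ⟨Z i, hmem i, a i, ⟨ha.1 i, (ha.2 i).trans (hA _ (hmem i))⟩, hsupp a ha i x hi⟩
  · refine ⟨⋃ i ∈ {i : T.range | Metric.infDist (i : Space n) K ≤ r}, piece ε U Z a i,
      .biUnion (to_countable _) fun i _ => measurableSet_piece ε hUo Z a i, ?_, ?_⟩
    · set Q := ⋃ i ∈ {i : T.range | Metric.infDist (i : Space n) K ≤ r}, piece ε U Z a i
      have hQ : MeasurableSet Q :=
        .biUnion (to_countable _) fun i _ => measurableSet_piece ε hUo Z a i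
      -- the energy refracted away from `K` is at most the measure of the complement of `K`
      have h1 : ν Qᶜ ≤ μ Kᶜ := by
        set F := Finset.univ.filter fun i : T.range => ¬ Metric.infDist (i : Space n) K ≤ r
        have h2 : Qᶜ ⊆ Uᶜ ∪ ⋃ i ∈ F, piece ε U Z a i := by
          intro x hx
          by_cases hxU : x ∈ U
          · right
            obtain ⟨i, hi⟩ := hcov a x hxU
            refine mem_biUnion (show i ∈ F from ?_) hi
            refine Finset.mem_filter.2 ⟨Finset.mem_univ _, fun h => hx ?_⟩
            exact mem_biUnion (show i ∈ {i : T.range | Metric.infDist (i : Space n) K ≤ r} from h) hi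
          · exact Or.inl hxU
        have h3 : ∑ i ∈ F, μ (T ⁻¹' {(i : Space n)}) =
            μ (T ⁻¹' (F.image Subtype.val : Finset (Space n))) := by
          rw [← sum_measure_preimage_singleton _ fun y _ => T.measurableSet_fiber y,
            Finset.sum_image fun i _ j _ h => Subtype.ext h]
        have h4 : T ⁻¹' (F.image Subtype.val : Finset (Space n)) ⊆ Kᶜ := by
          intro Y hY hYK
          obtain ⟨i, hi, hiY⟩ := Finset.mem_image.1 (Finset.mem_coe.1 hY)
          refine (Finset.mem_filter.1 hi).2 ?_
          rw [hiY]
          exact (Metric.infDist_le_dist_of_mem hYK).trans (hT Y (hKV hYK))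
        calc ν Qᶜ ≤ ν (Uᶜ ∪ ⋃ i ∈ F, piece ε U Z a i) := measure_mono h2
          _ ≤ ν Uᶜ + ν (⋃ i ∈ F, piece ε U Z a i) := measure_union_le _ _
          _ ≤ 0 + ∑ i ∈ F, ν (piece ε U Z a i) := by
            rw [hνU]; gcongr; exact measure_biUnion_finset_le _ _
          _ ≤ ∑ i ∈ F, μ (T ⁻¹' {(i : Space n)}) := by
            rw [zero_add]; exact Finset.sum_le_sum fun i _ => hle i
          _ ≤ μ Kᶜ := h3.trans_le (measure_mono h4)
      have h5 : μ Kᶜ ≠ ⊤ := ne_top_of_le_ne_top (hμν ▸ measure_ne_top ν univ)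
        (measure_mono (subset_univ _))
      refine ENNReal.le_of_add_le_add_right h5 ?_
      rw [measure_add_measure_compl hK, hμν, ← measure_add_measure_compl hQ]
      gcongr
    · intro x hx
      obtain ⟨i, hi, hxi⟩ := mem_iUnion₂.1 hx
      exact ⟨Z i, hmem i, hi, a i, ⟨ha.1 i, (ha.2 i).trans (hA _ (hmem i))⟩, hsupp a ha i x hxi⟩

/-- Limits of supporting hyperboloids are supporting hyperboloids of the limit. -/
theorem exists_supports_of_frequently {n : ℕ} {ε : ℝ} {U : Set (Base n)} {V : Set (Space n)}
    (hVc : IsCompact V) {w : ℕ → Base n → ℝ} {u : Base n → ℝ}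
    (hlim : ∀ x ∈ U, Tendsto (fun k => w k x) atTop (𝓝 (u x))) {δ A : ℝ} (hδ : 0 < δ)
    {K : Set (Space n)} (hK : IsClosed K) (hKn : K.Nonempty) {r : ℕ → ℝ}
    (hr : Tendsto r atTop (𝓝 0)) {x : Base n} (hx : x ∈ U)
    (h : ∃ᶠ k in atTop, ∃ Z ∈ V, Metric.infDist Z K ≤ r k ∧ ∃ a ∈ Icc δ A,
      Supports ε U (w k) x a Z) :
    ∃ Z ∈ K, ∃ a, Supports ε U u x a Z := by
  set P : Set ℕ := {k | ∃ Z ∈ V, Metric.infDist Z K ≤ r k ∧ ∃ a ∈ Icc δ A,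
      Supports ε U (w k) x a Z} with hP
  have : ∀ k, ∃ q : ℝ × Space n, k ∈ P → q.2 ∈ V ∧ Metric.infDist q.2 K ≤ r k ∧ q.1 ∈ Icc δ A ∧
      Supports ε U (w k) x q.1 q.2 := fun k => by
    by_cases hk : k ∈ P
    · obtain ⟨Z, hZ, hZK, a, ha, hs⟩ := hk
      exact ⟨(a, Z), fun _ => ⟨hZ, hZK, ha, hs⟩⟩
    · exact ⟨(0, 0), fun h => absurd h hk⟩
  choose q hq using this
  have hne : (atTop ⊓ 𝓟 P).NeBot := frequently_mem_iff_neBot.1 h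
  set F : Ultrafilter ℕ := Ultrafilter.of (atTop ⊓ 𝓟 P)
  have hF : (F : Filter ℕ) ≤ atTop ⊓ 𝓟 P := Ultrafilter.of_le _
  have hFa : (F : Filter ℕ) ≤ atTop := hF.trans inf_le_left
  have hFP : ∀ᶠ k in (F : Filter ℕ), k ∈ P := hF.trans inf_le_right (mem_principal_self P)
  have hcomp : IsCompact (Icc δ A ×ˢ V) := isCompact_Icc.prod hVc
  obtain ⟨⟨a, Z⟩, haZ, hlimq⟩ := hcomp.ultrafilter_le_nhds (F.map q)
    (le_principal_iff.2 (hFP.mono fun k hk => ⟨(hq k hk).2.2.1, (hq k hk).1⟩))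
  have hq' : Tendsto q F (𝓝 (a, Z)) := hlimq
  have ha : 0 < a := hδ.trans_le haZ.1.1
  have hhyp : ∀ y, Tendsto (fun k => hyp ε y (q k).1 (q k).2) F (𝓝 (hyp ε y a Z)) := fun y =>
    (continuousAt_hyp ε y ha Z).tendsto.comp hq'
  refine ⟨Z, ?_, a, ha, ?_, fun y hy => ?_⟩
  · rw [hK.mem_iff_infDist_zero hKn]
    refine le_antisymm ?_ Metric.infDist_nonneg
    refine le_of_tendsto_of_tendsto
      ((Metric.continuous_infDist_pt K).continuousAt.tendsto.comp
        ((continuous_snd.tendsto (a, Z)).comp hq')) (hr.mono_left hFa) ?_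
    exact hFP.mono fun k hk => (hq k hk).2.1
  · refine tendsto_nhds_unique ((hhyp x).congr' ?_) ((hlim x hx).mono_left hFa)
    exact hFP.mono fun k hk => (hq k hk).2.2.2.2.1
  · refine le_of_tendsto_of_tendsto ((hlim y hy).mono_left hFa) (hhyp y) ?_
    exact hFP.mono fun k hk => (hq k hk).2.2.2.2.2 y hy

/-- A bounded sequence of functions with a common Lipschitz constant has a pointwise convergent
subsequence. -/
theorem exists_subseq_tendsto {X : Type*} [MetricSpace X] [SecondCountableTopology X] {U : Set X}
    (hUn : U.Nonempty) {L : NNReal} {m : ℝ} {w : ℕ → X → ℝ}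
    (hw : ∀ k, LipschitzOnWith L (w k) U) (hb : ∀ k, ∀ x ∈ U, w k x ∈ Icc 0 m) :
    ∃ φ : ℕ → ℕ, StrictMono φ ∧ ∃ u : X → ℝ,
      ∀ x ∈ U, Tendsto (fun k => w (φ k) x) atTop (𝓝 (u x)) := by
  have := hUn.to_subtype
  set e : ℕ → U := TopologicalSpace.denseSeq U
  have hc : IsCompact (pi univ fun _ : ℕ => Icc 0 m) := isCompact_univ_pi fun _ => isCompact_Icc
  obtain ⟨v, -, φ, hφ, hv⟩ := hc.tendsto_subseq (x := fun k i => w k (e i))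
    fun k i _ => hb k _ (e i).2
  have hconv : ∀ x ∈ U, ∃ l, Tendsto (fun k => w (φ k) x) atTop (𝓝 l) := by
    intro x hx
    refine cauchySeq_tendsto_of_complete (Metric.cauchySeq_iff'.2 fun η hη => ?_)
    obtain ⟨i, hi⟩ := (TopologicalSpace.denseRange_denseSeq U).exists_dist_lt (⟨x, hx⟩ : U)
      (show 0 < η / (4 * (L + 1)) by positivity)
    have hLi : ∀ k, dist (w k x) (w k (e i)) < η / 4 := fun k => by
      refine ((hw k).dist_le_mul x hx _ (e i).2).trans_lt ?_
      have h1 : dist x (e i : X) < η / (4 * (L + 1)) := hi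
      rw [lt_div_iff₀ (by positivity)] at h1
      nlinarith [L.coe_nonneg, dist_nonneg (x := x) (y := (e i : X))]
    have h2 : CauchySeq fun k => w (φ k) (e i) :=
      (((continuous_apply i).tendsto v).comp hv).cauchySeq
    obtain ⟨N, hN⟩ := Metric.cauchySeq_iff'.1 h2 (η / 4) (by positivity)
    refine ⟨N, fun k hk => ?_⟩
    have h3 := hN k hk
    have h4 := dist_triangle4_right (w (φ k) x) (w (φ N) x) (w (φ k) (e i)) (w (φ N) (e i))
    have h5 := hLi (φ k)
    have h6 := hLi (φ N)
    linarith
  choose! u hu using hconv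
  exact ⟨φ, hφ, u, hu⟩

/-- Under the span and level conditions, there is a surface in the slab that refracts at least
the energy `μ K` into every compact subset `K` of a compact target. -/
theorem exists_le_measure_sourceSet {n : ℕ} (hn : 1 ≤ n) {ε : ℝ} (hε : 1 < ε)
    {U : Set (Base n)} (hUo : IsOpen U) (hUb : Bornology.IsBounded U) (hUn : U.Nonempty)
    {ψ : Space n → ℝ} (hψ : ContDiff ℝ ∞ ψ) {m₀ : ℝ} (hvis : Visible ψ U m₀)
    {V : Set (Space n)} (hVS : V ⊆ receiver ψ) (hVc : IsCompact V) (hVn : V.Nonempty)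
    (hS : SpanCondition ε U V) (hL : AboveMaxLevel ε U V m₀)
    {ν : Measure (Base n)} [IsFiniteMeasure ν] (hν : ν ≪ volume) (hνU : ν Uᶜ = 0)
    {μ : Measure (Space n)} (hμν : μ univ = ν univ) :
    ∃ u : Base n → ℝ, Admissible ε U V u ∧ InSlab U m₀ u ∧
      ∀ K ⊆ V, IsCompact K → μ K ≤ ν (sourceSet ε U u K) := by
  obtain ⟨ρ, hρ, hρV⟩ := exists_visRadius_lower hn hUo hUb hUn
  have hpos : ∀ Z ∈ V, 0 < maxAxis ε U Z := fun Z hZ =>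
    maxAxis_pos hε (hρ.trans_le (hρV _)) (hS Z hZ)
  obtain ⟨δ, hδ, hδV⟩ := exists_small_axis hn hε hUo hUb hUn hS
  have hδA : ∀ Z ∈ V, δ ≤ maxAxis ε U Z := fun Z hZ => by
    obtain ⟨x, hx⟩ := hUn
    by_contra! h
    exact not_lt.2 (hyp_anti hε (hpos Z hZ) h.le x Z) (hδV Z hZ Z hZ x hx)
  obtain ⟨A, hA⟩ := exists_maxAxis_le (U := U) hε hVc.isBounded
  have happ := fun k : ℕ => exists_approximate hε hUo hUb hψ hvis hVS hVc hVn hL hδ hδV hδA hA hν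
    hνU hμν (r := 1 / ((k : ℝ) + 1)) (by positivity)
  choose w hw hwV hwK using happ
  obtain ⟨φ, hφ, u, hu⟩ := exists_subseq_tendsto hUn
    (fun k => Admissible.lipschitzOnWith hε (V := V) fun x hx => by
      obtain ⟨Z, hZ, a, -, h⟩ := hwV k x hx
      exact ⟨Z, hZ, a, h⟩)
    (fun k x hx => by
      have h := (hw k x hx).2
      rwa [height_pt] at h)
  have hr : Tendsto (fun k => 1 / ((φ k : ℝ) + 1)) atTop (𝓝 0) :=
    tendsto_one_div_add_atTop_nhds_zero_nat.comp hφ.tendsto_atTop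
  refine ⟨u, fun x hx => ?_, fun x hx => ⟨by rwa [proj_pt], ?_⟩, fun K hKV hK => ?_⟩
  · refine exists_supports_of_frequently hVc hu hδ (A := A) hVc.isClosed hVn hr hx
      (Eventually.of_forall fun k => ?_).frequently
    obtain ⟨Z, hZ, a, ha, h⟩ := hwV (φ k) x hx
    exact ⟨Z, hZ, by rw [Metric.infDist_zero_of_mem hZ]; positivity, a, ha, h⟩
  · rw [height_pt]
    refine isClosed_Icc.mem_of_tendsto (hu x hx) (Eventually.of_forall fun k => ?_)
    have h := (hw (φ k) x hx).2
    rwa [height_pt] at h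
  · rcases K.eq_empty_or_nonempty with rfl | hKn
    · simp
    have hQ := fun k => hwK (φ k) K hK.measurableSet hKV
    choose Q hQm hQ hQx using hQ
    -- points off `U` do not matter
    have h1 : ∀ k, μ K ≤ ν (Q k ∩ U) := fun k => by
      refine (hQ k).trans ?_
      rw [← measure_inter_add_sdiff (Q k) hUo.measurableSet,
        measure_mono_null (fun x hx => hx.2 : Q k \ U ⊆ Uᶜ) hνU, add_zero]
    refine le_measure_of_frequently (fun k => (hQm k).inter hUo.measurableSet) h1 fun x hx => ?_
    have hxU : x ∈ U := hx.exists.choose_spec.2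
    exact ⟨hxU, exists_supports_of_frequently hVc hu hδ hK.isClosed hKn hr hxU
      (hx.mono fun k hk => hQx k x hk.1)⟩

/-- Existence of solutions of type B for a compact target. -/
theorem exists_isBType {n : ℕ} (hn : 1 ≤ n) {ε : ℝ} (hε : 1 < ε)
    {U : Set (Base n)} (hUo : IsOpen U) (hUb : Bornology.IsBounded U) (hUn : U.Nonempty)
    {ψ : Space n → ℝ} (hψ : ContDiff ℝ ∞ ψ) {m₀ : ℝ} (hvis : Visible ψ U m₀)
    {V : Set (Space n)} (hV : IsTarget (receiver ψ) V)
    {f : Base n → ℝ} (hf : IntegrableOn f U) (hf0 : ∀ x ∈ U, 0 ≤ f x)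
    {g : Space n → ℝ} (hg : IntegrableOn g V μHE[n]) (hg0 : ∀ Z ∈ V, 0 ≤ g Z)
    (hE : EnergyBalance U V f g) (hVc : IsClosed V) (hS : SpanCondition ε U V)
    (hL : AboveMaxLevel ε U V m₀) :
    ∃ u : Base n → ℝ, IsBType ε U V f g u ∧ InSlab U m₀ u := by
  obtain ⟨hVS, hVb, hVm, O, -, hOn, hOV, -⟩ := hV
  have hVn : V.Nonempty := hOn.mono hOV
  have hVcomp : IsCompact V := Metric.isCompact_of_isClosed_isBounded hVc hVb
  set ν : Measure (Base n) := (volume.restrict U).withDensity fun x => ENNReal.ofReal (f x) with hν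
  set μ : Measure (Space n) :=
    (Measure.restrict μHE[n] V).withDensity fun Z => ENNReal.ofReal (g Z) with hμ
  have hνS : ∀ S ⊆ U, ν S = ∫⁻ x in S, ENNReal.ofReal (f x) := fun S hS => by
    rw [hν, withDensity_apply', Measure.restrict_restrict_of_subset hS]
  have hμB : ∀ B ⊆ V, MeasurableSet B → μ B = ∫⁻ Z in B, ENNReal.ofReal (g Z) ∂μHE[n] :=
    fun B hB hBm => by
    rw [hμ, withDensity_apply _ hBm, Measure.restrict_restrict_of_subset hB]
  have hνU : ν Uᶜ = 0 := by
    rw [hν]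
    refine withDensity_absolutelyContinuous _ _ ?_
    rw [Measure.restrict_apply hUo.measurableSet.compl, compl_inter_self, measure_empty]
  have hμV : μ Vᶜ = 0 := by
    rw [hμ]
    refine withDensity_absolutelyContinuous _ _ ?_
    rw [Measure.restrict_apply hVm.compl, compl_inter_self, measure_empty]
  have hνvol : ν ≪ volume := (withDensity_absolutelyContinuous _ _).trans
    Measure.restrict_le_self.absolutelyContinuous
  have hνfin : IsFiniteMeasure ν :=
    isFiniteMeasure_withDensity_ofReal hf.hasFiniteIntegral
  have hμfin : IsFiniteMeasure μ :=
    isFiniteMeasure_withDensity_ofReal hg.hasFiniteIntegral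
  have hνuniv : ν univ = ν U := (measure_of_measure_compl_eq_zero hνU).symm
  have hμuniv : μ univ = μ V := (measure_of_measure_compl_eq_zero hμV).symm
  have hμν : μ univ = ν univ := by
    rw [hνuniv, hμuniv, hνS U le_rfl, hμB V le_rfl hVm,
      ← ofReal_integral_eq_lintegral_ofReal hf ((ae_restrict_iff' hUo.measurableSet).2
        (Eventually.of_forall hf0)),
      ← ofReal_integral_eq_lintegral_ofReal hg ((ae_restrict_iff' hVm).2
        (Eventually.of_forall hg0))]
    exact congrArg _ hE.symm
  obtain ⟨u, hadm, hslab, hK⟩ := exists_le_measure_sourceSet hn hε hUo hUb hUn hψ hvis hVS hVcomp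
    hVn hS hL hνvol hνU hμν
  have hSV : sourceSet ε U u V = U := by
    ext x
    exact ⟨fun h => h.1, fun h => ⟨h, hadm x h⟩⟩
  -- by inner regularity, the inequality extends from compact sets to Borel sets
  have hle : ∀ B ⊆ V, MeasurableSet B → μ B ≤ ν (sourceSet ε U u B) := fun B hBV hB => by
    rw [hB.measure_eq_iSup_isCompact_of_ne_top (measure_ne_top μ B)]
    refine iSup₂_le fun K hKB => iSup_le fun hKc => (hK K (hKB.trans hBV) hKc).trans ?_
    exact measure_mono fun x hx => ⟨hx.1, hx.2.imp fun Z h => ⟨hKB h.1, h.2⟩⟩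
  refine ⟨u, ⟨hadm, fun B hBV hB => ?_, hSV⟩, hslab⟩
  rw [beta, ← hνS _ fun x hx => hx.1, ← hμB B hBV hB]
  refine le_antisymm ?_ (hle B hBV hB)
  -- the reverse inequality follows by applying the first one to the complement
  have hC := hle (V \ B) sdiff_subset (hVm.diff hB)
  have hd : AEDisjoint ν (sourceSet ε U u B) (sourceSet ε U u (V \ B)) :=
    hνvol (aedisjoint_source hε hUo hψ hvis hadm hslab (hBV.trans hVS)
      (sdiff_subset.trans hVS) disjoint_sdiff_right)
  have hm : NullMeasurableSet (sourceSet ε U u (V \ B)) ν :=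
    (nullMeasurableSet_source hε hUo hUb hUn hψ hvis hadm hslab (sdiff_subset.trans hVS)
      (hVm.diff hB)).mono_ac hνvol
  refine ENNReal.le_of_add_le_add_right (measure_ne_top μ (V \ B)) ?_
  calc ν (sourceSet ε U u B) + μ (V \ B)
      ≤ ν (sourceSet ε U u B) + ν (sourceSet ε U u (V \ B)) := by gcongr
    _ = ν (sourceSet ε U u B ∪ sourceSet ε U u (V \ B)) := (measure_union₀ hm hd).symm
    _ ≤ ν univ := measure_mono (subset_univ _)
    _ = μ B + μ (V \ B) := by
      rw [← hμν, hμuniv, ← measure_inter_add_sdiff V hB, inter_eq_self_of_subset_right hBV]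

end Refractor

theorem theoremC (n : ℕ) (hn : 1 ≤ n) (ε : ℝ) (hε : 1 < ε)
    (U : Set (Refractor.Base n)) (hUo : IsOpen U) (hUn : U.Nonempty)
    (hUb : Bornology.IsBounded U)
    (ψ : Refractor.Space n → ℝ) (hψ : ContDiff ℝ ∞ ψ)
    (V : Set (Refractor.Space n)) (hV : Refractor.IsTarget (Refractor.receiver ψ) V)
    (f : Refractor.Base n → ℝ) (hf : IntegrableOn f U) (hf0 : ∀ x ∈ U, 0 ≤ f x)
    (g : Refractor.Space n → ℝ) (hg : IntegrableOn g V μHE[n]) (hg0 : ∀ Z ∈ V, 0 ≤ g Z)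
    (m₀ : ℝ) (hm₀ : 0 < m₀) (hvis : Refractor.Visible ψ U m₀) :
    -- (1) existence of a `B`-type weak solution
    (Refractor.EnergyBalance U V f g → IsClosed V → Refractor.SpanCondition ε U V →
      Refractor.AboveMaxLevel ε U V m₀ →
      ∃ u : Refractor.Base n → ℝ, Refractor.IsBType ε U V f g u ∧ Refractor.InSlab U m₀ u) ∧
    -- (2) `α_{u,g}` is defined on the Borel subsets of `U` and countably additive
    (Refractor.Separated U V →
      ∀ u : Refractor.Base n → ℝ, Refractor.Admissible ε U V u → Refractor.InSlab U m₀ u →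
        (∀ E : Set (Refractor.Base n), E ⊆ U → MeasurableSet E →
          NullMeasurableSet (Refractor.refractorSet ε U (Refractor.receiver ψ) u E ∩ V) μHE[n]) ∧
        ∀ E : ℕ → Set (Refractor.Base n), (∀ i, E i ⊆ U) → (∀ i, MeasurableSet (E i)) →
          Pairwise (Function.onFun Disjoint E) →
          Refractor.alpha ε U (Refractor.receiver ψ) V u g (⋃ i, E i) =
            ∑' i, Refractor.alpha ε U (Refractor.receiver ψ) V u g (E i)) ∧
    -- (3) `R`-convex target and `g > 0`: each `B`-type weak solution is of `A`-type, and an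
    -- `A`-type weak solution exists
    (Refractor.Separated U V → (∀ ξ ∈ Refractor.slab U m₀, Refractor.IsRConvexAt ε V ξ) →
      Refractor.SpanCondition ε U V →
      (∀ Z ∈ V, 0 < g Z) →
      (∀ u : Refractor.Base n → ℝ, Refractor.IsBType ε U V f g u → Refractor.InSlab U m₀ u →
        Refractor.IsAType ε U (Refractor.receiver ψ) V f g u) ∧
      (Refractor.EnergyBalance U V f g → IsClosed V → Refractor.AboveMaxLevel ε U V m₀ →
        ∃ u : Refractor.Base n → ℝ, Refractor.IsAType ε U (Refractor.receiver ψ) V f g u)) ∧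
    -- (4) the same without `R`-convexity, for `f, g > 0`
    (Refractor.Separated U V → Refractor.SpanCondition ε U V →
      (∀ x ∈ U, 0 < f x) → (∀ Z ∈ V, 0 < g Z) →
      (∀ u : Refractor.Base n → ℝ, Refractor.IsBType ε U V f g u → Refractor.InSlab U m₀ u →
        Refractor.IsAType ε U (Refractor.receiver ψ) V f g u) ∧
      (Refractor.EnergyBalance U V f g → IsClosed V → Refractor.AboveMaxLevel ε U V m₀ →
        ∃ u : Refractor.Base n → ℝ, Refractor.IsAType ε U (Refractor.receiver ψ) V f g u)) := by
  have hcont := fun u (hu : Refractor.Admissible ε U V u) =>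
    (hu.lipschitzOnWith hε).continuousOn
  have hex := fun hE hVc hS hL =>
    Refractor.exists_isBType hn hε hUo hUb hUn hψ hvis hV hf hf0 hg hg0 hE hVc hS hL
  have hBA : (∀ Z ∈ V, 0 < g Z) → ∀ u : Refractor.Base n → ℝ, Refractor.IsBType ε U V f g u →
      Refractor.InSlab U m₀ u → Refractor.IsAType ε U (Refractor.receiver ψ) V f g u :=
    fun hgp u hu hs => hu.isAType hε hUo hUb hUn hψ hvis hV hg.aemeasurable hgp hs
  have hexA : Refractor.SpanCondition ε U V → (∀ Z ∈ V, 0 < g Z) →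
      Refractor.EnergyBalance U V f g → IsClosed V → Refractor.AboveMaxLevel ε U V m₀ →
      ∃ u : Refractor.Base n → ℝ, Refractor.IsAType ε U (Refractor.receiver ψ) V f g u :=
    fun hS hgp hE hVc hL => by
      obtain ⟨u, hu, hs⟩ := hex hE hVc hS hL
      exact ⟨u, hBA hgp u hu hs⟩
  refine ⟨hex, fun _ u hu hs => ⟨fun E hE hEm => ?_, fun E hE hEm hd => ?_⟩,
    fun _ _ hS hgp => ⟨hBA hgp, hexA hS hgp⟩, fun _ hS _ hgp => ⟨hBA hgp, hexA hS hgp⟩⟩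
  · exact Refractor.nullMeasurableSet_refractor hε hUo hUb hUn hψ hvis hV.1 hV.2.2.1
      (hcont u hu) hs hE hEm
  · exact Refractor.alpha_iUnion hε hUo hUb hUn hψ hvis hV.1 hV.2.2.1 (hcont u hu) hs g hE hEm hd
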